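/- Let $(M,g)$ be a smooth Riemannian manifold of dimension $4$ with Levi-Civita connection $\nabla$, Ricci tensor $\rho$, Ricci endomorphism $\mathrm{Ric}$ (so $\rho(X,Y)=g(\mathrm{Ric}\,X,Y)$) and scalar curvature $\tau$. Let $J,\bar J$ be endomorphism fields of $TM$ such that $(M,g,J,\bar J)$ is a bi-Hermitian Gray surface, that is: (i) $(M,g)$ is irreducible (the only parallel smooth distributions are $0$ and $TM$); (ii) for all smooth vector fields $X,Y,Z$, with $\mathfrak C$ denoting the cyclic sum and $\dim M=4$, $$\mathfrak C_{XYZ}\,(\nabla_X\rho)(Y,Z)=\frac{2}{\dim M+2}\,\mathfrak C_{XYZ}\,(X\tau)\,g(Y,Z);$$ (iii) $J$ and $\bar J$ are Hermitian complex structures (smooth, $J^2=-\mathrm{Id}$, $g(JX,JY)=g(X,Y)$, integrable, and likewise for $\bar J$) which induce opposite orientations of $M$; (iv) $J$ and $\bar J$ commute with $\mathrm{Ric}$. Let $S_0=\mathrm{Ric}-\frac{\tau}{3}\mathrm{Id}$, that is, $\rho(X,Y)=g(S_0X,Y)+\frac{\tau}{3}g(X,Y)$. Then $S_0$ is a Killing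 tensor, i.e. $g((\nabla_XS_0)X,X)=0$ for all vector fields $X$; and if $\xi$ is a Killing vector field on $(M,g)$ with $\nabla_\xi J=\nabla_\xi\bar J=0$, then $S_0\xi$ is a Killing vector field on $(M,g)$. -/

import Mathlib

open Bundle
open scoped Manifold ContDiff

namespace BiHermitian

section General

variable {E : Type*} [NormedAddCommGroup E] [NormedSpace ℝ E] [FiniteDimensional ℝ E]
  {H : Type*} [TopologicalSpace H] {I : ModelWithCorners ℝ E H}
  {M : Type*} [TopologicalSpace M] [ChartedSpace H M] [IsManifold I ∞ M]

instance tangentSpace_finiteDimensional (x : M) : FiniteDimensional ℝ (TangentSpace I x) :=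
  inferInstanceAs (FiniteDimensional ℝ E)

instance tangentSpace_t2Space (x : M) : T2Space (TangentSpace I x) :=
  inferInstanceAs (T2Space E)

/-! ### Riemannian metrics and the Levi-Civita connection -/

/-- A smooth Riemannian metric on the manifold `M`; `g.inner x v w` is `g(v, w)`. -/
abbrev Metric (I : ModelWithCorners ℝ E H) (M : Type*) [TopologicalSpace M] [ChartedSpace H M]
    [IsManifold I ∞ M] : Type _ :=
  ContMDiffRiemannianMetric I ∞ E (fun x : M => TangentSpace I x)

/-- The vector field `X` is smooth. -/
def IsSmoothField (X : Π x : M, TangentSpace I x) : Prop := CMDiff ∞ (T% X)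

/-- The field of endomorphisms `A` of the tangent bundle is smooth: it maps smooth vector fields
to smooth vector fields. -/
def IsSmoothEndo (A : Π x : M, TangentSpace I x →ₗ[ℝ] TangentSpace I x) : Prop :=
  ∀ X : Π x : M, TangentSpace I x, IsSmoothField X → IsSmoothField (fun x => A x (X x))

/-- The lowering of indices `v ↦ g(v, ·)`, an isomorphism from a tangent space to its dual. -/
noncomputable def flat (g : Metric I M) (x : M) :
    TangentSpace I x ≃ₗ[ℝ] Module.Dual ℝ (TangentSpace I x) :=
  LinearEquiv.ofInjectiveOfFinrankEq
    (ContinuousLinearMap.coeLM ℝ ∘ₗ (g.inner x : TangentSpace I x →ₗ[ℝ] _))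
    (by
      rw [injective_iff_map_eq_zero]
      intro v hv
      by_contra h
      have h1 := g.pos x v h
      have h2 := congr($hv v)
      simp at h2
      exact h1.ne' h2)
    (Subspace.dual_finrank_eq).symm

@[simp] lemma flat_apply (g : Metric I M) (x : M) (v w : TangentSpace I x) :
    flat g x v w = g.inner x v w := rfl

/-- Twice `g(∇_X Y, Z)`, as given by the Koszul formula. -/
noncomputable def koszul (g : Metric I M) (X Y Z : Π x : M, TangentSpace I x) (x : M) : ℝ :=
  d% (fun y => g.inner y (Y y) (Z y)) x (X x)
    + d% (fun y => g.inner y (Z y) (X y)) x (Y x)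
    - d% (fun y => g.inner y (X y) (Y y)) x (Z x)
    + g.inner x (VectorField.mlieBracket I X Y x) (Z x)
    - g.inner x (VectorField.mlieBracket I Y Z x) (X x)
    + g.inner x (VectorField.mlieBracket I Z X x) (Y x)

lemma mdifferentiableAt_inner (g : Metric I M) {X Y : Π x : M, TangentSpace I x} {x : M}
    (hX : MDiffAt (T% X) x) (hY : MDiffAt (T% Y) x) :
    MDiffAt (fun y => g.inner y (X y) (Y y)) x := by
  have h : MDifferentiableAt I (I.prod 𝓘(ℝ, ℝ))
      (fun y => TotalSpace.mk' ℝ (E := Bundle.Trivial M ℝ) y (g.inner y (X y) (Y y))) x :=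
    MDifferentiableAt.clm_bundle_apply₂ (F₁ := E) (F₂ := E)
      (g.contMDiff.mdifferentiableAt (by simp)) hX hY
  rw [mdifferentiableAt_totalSpace] at h
  exact h.2

lemma koszul_add (g : Metric I M) {X Y Y' Z : Π x : M, TangentSpace I x} {x : M}
    (hX : MDiffAt (T% X) x) (hY : MDiffAt (T% Y) x) (hY' : MDiffAt (T% Y') x)
    (hZ : MDiffAt (T% Z) x) :
    koszul g X (Y + Y') Z x = koszul g X Y Z x + koszul g X Y' Z x := by
  have := mdifferentiableAt_inner g hY hZ
  have := mdifferentiableAt_inner g hY' hZ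
  have := mdifferentiableAt_inner g hX hY
  have := mdifferentiableAt_inner g hX hY'
  simp only [koszul, Pi.add_apply, map_add, add_apply]
  rw [mvfderiv_fun_add, mvfderiv_fun_add, VectorField.mlieBracket_add_left,
    VectorField.mlieBracket_add_right]
  · simp only [map_add, add_apply]
    ring
  all_goals assumption

lemma koszul_smul (g : Metric I M) {X Y Z : Π x : M, TangentSpace I x} {f : M → ℝ} {x : M}
    (hX : MDiffAt (T% X) x) (hY : MDiffAt (T% Y) x)
    (hZ : MDiffAt (T% Z) x) (hf : MDiffAt f x) :
    koszul g X (f • Y) Z x =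
      f x * koszul g X Y Z x + 2 * (d% f x (X x) * g.inner x (Y x) (Z x)) := by
  have := mdifferentiableAt_inner g hY hZ
  have := mdifferentiableAt_inner g hX hY
  simp only [koszul, Pi.smul_apply', map_smul, smul_apply, smul_eq_mul]
  rw [mvfderiv_fun_mul, mvfderiv_fun_mul, VectorField.mlieBracket_smul_left,
    VectorField.mlieBracket_smul_right]
  · simp only [map_add, map_smul, add_apply, smul_apply, smul_eq_mul, neg_smul, map_neg, neg_apply]
    rw [g.symm x (Y x) (X x)]
    ring
  all_goals assumption

/-- A basis of the tangent space at `x`. The tensors below are defined by their values on the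
vectors of this basis and extended by linearity; the choice of the basis is irrelevant. -/
noncomputable def tangentBasis (x : M) :
    Module.Basis (Fin (Module.finrank ℝ E)) ℝ (TangentSpace I x) :=
  Module.finBasis ℝ E

/-- A vector field defined on `M`, smooth near `x`, whose value at `x` is the `i`-th vector of the
basis `tangentBasis x`. -/
noncomputable def tangentFrame (x : M) (i : Fin (Module.finrank ℝ E)) :
    Π y : M, TangentSpace I y :=
  FiberBundle.extend E (tangentBasis x i : TangentSpace I x)

/-- The endomorphism `v ↦ ∇_v Y` of the tangent space at `x`, where `∇_v Y` is the vector which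
satisfies the Koszul formula. -/
noncomputable def leviCivitaAux (g : Metric I M) (Y : Π x : M, TangentSpace I x) (x : M) :
    TangentSpace I x →ₗ[ℝ] TangentSpace I x :=
  (tangentBasis x).constr ℝ fun i =>
    (1 / 2 : ℝ) • (flat g x).symm ((tangentBasis x).constr ℝ fun j =>
      koszul g (tangentFrame x i) Y (tangentFrame x j) x)

lemma mdifferentiableAt_tangentFrame (x : M) (i : Fin (Module.finrank ℝ E)) :
    MDiffAt (T% (tangentFrame x i : Π y : M, TangentSpace I y)) x :=
  FiberBundle.mdifferentiableAt_extend ..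

@[simp] lemma tangentFrame_self (x : M) (i : Fin (Module.finrank ℝ E)) :
    tangentFrame x i x = (tangentBasis x i : TangentSpace I x) :=
  FiberBundle.extend_apply_self ..

lemma flat_leviCivitaAux (g : Metric I M) (Y : Π x : M, TangentSpace I x) (x : M)
    (i j : Fin (Module.finrank ℝ E)) :
    flat g x (leviCivitaAux g Y x (tangentBasis x i)) (tangentBasis x j) =
      (1 / 2 : ℝ) * koszul g (tangentFrame x i) Y (tangentFrame x j) x := by
  simp only [leviCivitaAux, Module.Basis.constr_basis, map_smul,
    LinearEquiv.apply_symm_apply, LinearMap.smul_apply, smul_eq_mul]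

/-- The Levi-Civita connection of the metric `g`: `leviCivita g Y x v` is `∇_v Y`. -/
noncomputable def leviCivita (g : Metric I M) :
    CovariantDerivative I E (TangentSpace I : M → Type _) where
  toFun Y x := (leviCivitaAux g Y x).toContinuousLinearMap
  isCovariantDerivativeOnUniv :=
  { add := by
      intro Y Y' x hY hY' _
      apply ContinuousLinearMap.coe_injective
      refine (tangentBasis x).ext fun i => (flat g x).injective ((tangentBasis x).ext fun j => ?_)
      simp only [LinearMap.coe_toContinuousLinearMap, ContinuousLinearMap.toLinearMap_add,
        LinearMap.add_apply, map_add, flat_leviCivitaAux]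
      rw [koszul_add g (mdifferentiableAt_tangentFrame x i) hY hY'
        (mdifferentiableAt_tangentFrame x j), mul_add]
    leibniz := by
      intro Y f x hY hf _
      apply ContinuousLinearMap.coe_injective
      refine (tangentBasis x).ext fun i => (flat g x).injective ((tangentBasis x).ext fun j => ?_)
      simp only [LinearMap.coe_toContinuousLinearMap, ContinuousLinearMap.toLinearMap_add,
        LinearMap.add_apply, map_add, flat_leviCivitaAux, map_smul, LinearMap.smul_apply,
        ContinuousLinearMap.toLinearMap_smul, ContinuousLinearMap.coe_coe,
        ContinuousLinearMap.smulRight_apply]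
      rw [koszul_smul g (mdifferentiableAt_tangentFrame x i) hY
        (mdifferentiableAt_tangentFrame x j) hf]
      simp only [tangentFrame_self, flat_apply, smul_eq_mul]
      ring }

lemma tensorialAt_koszul_left (g : Metric I M) {Y Z : Π x : M, TangentSpace I x} {x : M}
    (hY : MDiffAt (T% Y) x) (hZ : MDiffAt (T% Z) x) :
    TensorialAt I E (fun X => koszul g X Y Z x) x where
  smul := by
    intro f X hf hX
    have := mdifferentiableAt_inner g hZ hX
    have := mdifferentiableAt_inner g hX hY
    simp only [koszul, Pi.smul_apply', map_smul, smul_apply, smul_eq_mul]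
    rw [mvfderiv_fun_mul, mvfderiv_fun_mul, VectorField.mlieBracket_smul_left,
      VectorField.mlieBracket_smul_right]
    · simp only [map_add, map_smul, add_apply, smul_apply, smul_eq_mul, neg_smul, map_neg,
        neg_apply]
      rw [g.symm x (Z x) (X x)]
      ring
    all_goals assumption
  add := by
    intro X X' hX hX'
    have := mdifferentiableAt_inner g hZ hX
    have := mdifferentiableAt_inner g hX hY
    have := mdifferentiableAt_inner g hZ hX'
    have := mdifferentiableAt_inner g hX' hY
    simp only [koszul, Pi.add_apply, map_add, add_apply]
    rw [mvfderiv_fun_add, mvfderiv_fun_add, VectorField.mlieBracket_add_left,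
      VectorField.mlieBracket_add_right]
    · simp only [map_add, add_apply]
      ring
    all_goals assumption

lemma tensorialAt_koszul_right (g : Metric I M) {X Y : Π x : M, TangentSpace I x} {x : M}
    (hX : MDiffAt (T% X) x) (hY : MDiffAt (T% Y) x) :
    TensorialAt I E (fun Z => koszul g X Y Z x) x where
  smul := by
    intro f Z hf hZ
    have := mdifferentiableAt_inner g hY hZ
    have := mdifferentiableAt_inner g hZ hX
    simp only [koszul, Pi.smul_apply', map_smul, smul_apply, smul_eq_mul]
    rw [mvfderiv_fun_mul, mvfderiv_fun_mul, VectorField.mlieBracket_smul_left,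
      VectorField.mlieBracket_smul_right]
    · simp only [map_add, map_smul, add_apply, smul_apply, smul_eq_mul, neg_smul, map_neg,
        neg_apply]
      rw [g.symm x (Z x) (X x), g.symm x (Y x) (Z x)]
      ring
    all_goals assumption
  add := by
    intro Z Z' hZ hZ'
    have := mdifferentiableAt_inner g hY hZ
    have := mdifferentiableAt_inner g hZ hX
    have := mdifferentiableAt_inner g hY hZ'
    have := mdifferentiableAt_inner g hZ' hX
    simp only [koszul, Pi.add_apply, map_add, add_apply]
    rw [mvfderiv_fun_add, mvfderiv_fun_add, VectorField.mlieBracket_add_left,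
      VectorField.mlieBracket_add_right]
    · simp only [map_add, add_apply]
      ring
    all_goals assumption

/-- The Koszul formula. -/
lemma two_mul_inner_leviCivita (g : Metric I M) {X Y Z : Π x : M, TangentSpace I x} {x : M}
    (hX : MDiffAt (T% X) x) (hY : MDiffAt (T% Y) x) (hZ : MDiffAt (T% Z) x) :
    2 * g.inner x (leviCivita g Y x (X x)) (Z x) = koszul g X Y Z x := by
  let B := TensorialAt.mkHom₂ (fun X Z => koszul g X Y Z x) x
    (fun Z hZ => tensorialAt_koszul_left g hY hZ) (fun X hX => tensorialAt_koszul_right g hX hY)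
  have hB : B (X x) (Z x) = koszul g X Y Z x := TensorialAt.mkHom₂_apply _ _ hX hZ
  have key : (2 : ℝ) • ((flat g x).toLinearMap ∘ₗ leviCivitaAux g Y x) =
      ContinuousLinearMap.coeLM ℝ ∘ₗ (B : TangentSpace I x →ₗ[ℝ] _) := by
    refine (tangentBasis x).ext fun i => (tangentBasis x).ext fun j => ?_
    change 2 * flat g x (leviCivitaAux g Y x (tangentBasis x i)) (tangentBasis x j) =
      B (tangentBasis x i) (tangentBasis x j)
    rw [flat_leviCivitaAux]
    have : B (tangentBasis x i) (tangentBasis x j) =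
        koszul g (tangentFrame x i) Y (tangentFrame x j) x :=
      TensorialAt.mkHom₂_apply_eq_extend _ _ _ _
    rw [this]; ring
  rw [← hB]
  exact congr($key (X x) (Z x))

/-- The Levi-Civita connection is compatible with the metric. -/
lemma leviCivita_metric (g : Metric I M) {X Y Z : Π x : M, TangentSpace I x} {x : M}
    (hX : MDiffAt (T% X) x) (hY : MDiffAt (T% Y) x) (hZ : MDiffAt (T% Z) x) :
    d% (fun y => g.inner y (Y y) (Z y)) x (X x) =
      g.inner x (leviCivita g Y x (X x)) (Z x) + g.inner x (Y x) (leviCivita g Z x (X x)) := by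
  have h1 := two_mul_inner_leviCivita g hX hY hZ
  have h2 := two_mul_inner_leviCivita g hX hZ hY
  have e1 : ∀ A B : Π x : M, TangentSpace I x,
      (fun y => g.inner y (A y) (B y)) = fun y => g.inner y (B y) (A y) := fun A B => by
    ext y; exact g.symm y _ _
  rw [g.symm x (Y x)]
  simp only [koszul] at h1 h2
  rw [e1 Z Y, e1 Y X, e1 X Z, VectorField.mlieBracket_swap_apply (V := X) (W := Z),
    VectorField.mlieBracket_swap_apply (V := Z) (W := Y),
    VectorField.mlieBracket_swap_apply (V := Y) (W := X)] at h2
  simp only [map_neg, neg_apply] at h2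
  linarith

/-- The Levi-Civita connection is torsion-free. -/
lemma leviCivita_torsion (g : Metric I M) : (leviCivita g).torsion = 0 := by
  rw [CovariantDerivative.torsion_eq_zero_iff]
  intro X Y x hX hY
  apply (flat g x).injective
  refine (tangentBasis x).ext fun j => ?_
  have hZ := mdifferentiableAt_tangentFrame (I := I) x j
  rw [← tangentFrame_self]
  generalize (tangentFrame x j : Π y : M, TangentSpace I y) = Z at *
  have h1 := two_mul_inner_leviCivita g hX hY hZ
  have h2 := two_mul_inner_leviCivita g hY hX hZ
  have e1 : ∀ A B : Π x : M, TangentSpace I x,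
      (fun y => g.inner y (A y) (B y)) = fun y => g.inner y (B y) (A y) := fun A B => by
    ext y; exact g.symm y _ _
  simp only [koszul] at h1 h2
  rw [e1 X Z, e1 Z Y, e1 Y X, VectorField.mlieBracket_swap_apply (V := X) (W := Z),
    VectorField.mlieBracket_swap_apply (V := Z) (W := Y),
    VectorField.mlieBracket_swap_apply (V := Y) (W := X)] at h2
  simp only [map_neg, neg_apply] at h2
  simp only [map_sub, LinearMap.sub_apply, flat_apply]
  linarith

/-- The vector field `∇_X Y`. -/
noncomputable def covDeriv (g : Metric I M) (X Y : Π x : M, TangentSpace I x) :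
    Π x : M, TangentSpace I x :=
  fun x => leviCivita g Y x (X x)

/-- The vector field `(∇_X A) Y = ∇_X (A Y) - A (∇_X Y)`, for a field of endomorphisms `A`. -/
noncomputable def covDerivEndo (g : Metric I M) (X : Π x : M, TangentSpace I x)
    (A : Π x : M, TangentSpace I x →ₗ[ℝ] TangentSpace I x) (Y : Π x : M, TangentSpace I x) :
    Π x : M, TangentSpace I x :=
  fun x => covDeriv g X (fun y => A y (Y y)) x - A x (covDeriv g X Y x)

/-- The function `(∇_X ρ)(Y, Z) = X(ρ(Y, Z)) - ρ(∇_X Y, Z) - ρ(Y, ∇_X Z)`, for a field `ρ` of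
bilinear forms. -/
noncomputable def covDerivForm (g : Metric I M) (X : Π x : M, TangentSpace I x)
    (ρ : Π x : M, TangentSpace I x →ₗ[ℝ] TangentSpace I x →ₗ[ℝ] ℝ)
    (Y Z : Π x : M, TangentSpace I x) (x : M) : ℝ :=
  d% (fun y => ρ y (Y y) (Z y)) x (X x) - ρ x (covDeriv g X Y x) (Z x)
    - ρ x (Y x) (covDeriv g X Z x)

/-! ### Curvature -/

/-- The curvature `R(X, Y)Z = ∇_X ∇_Y Z - ∇_Y ∇_X Z - ∇_[X,Y] Z`. -/
noncomputable def curvature (g : Metric I M) (X Y Z : Π x : M, TangentSpace I x) :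
    Π x : M, TangentSpace I x :=
  fun x => covDeriv g X (covDeriv g Y Z) x - covDeriv g Y (covDeriv g X Z) x
    - covDeriv g (VectorField.mlieBracket I X Y) Z x

/-- The Ricci tensor as a bilinear form: `ρ(u, v)` is the trace of `w ↦ R(w, u)v`. -/
noncomputable def ricciForm (g : Metric I M) (x : M) :
    TangentSpace I x →ₗ[ℝ] TangentSpace I x →ₗ[ℝ] ℝ :=
  (tangentBasis x).constr ℝ fun i => (tangentBasis x).constr ℝ fun j =>
    LinearMap.trace ℝ (TangentSpace I x) ((tangentBasis x).constr ℝ fun k =>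
      curvature g (tangentFrame x k) (tangentFrame x i) (tangentFrame x j) x)

/-- The Ricci endomorphism: `g(Ric u, v) = ρ(u, v)`. -/
noncomputable def ricciEndo (g : Metric I M) (x : M) : TangentSpace I x →ₗ[ℝ] TangentSpace I x :=
  (flat g x).symm.toLinearMap ∘ₗ ricciForm g x

/-- The scalar curvature `τ`, the trace of the Ricci endomorphism. -/
noncomputable def scalarCurvature (g : Metric I M) (x : M) : ℝ :=
  LinearMap.trace ℝ (TangentSpace I x) (ricciEndo g x)

/-- The cyclic sum over `X, Y, Z` of `∇_X ρ(Y, Z)` equals `2 / (dim M + 2)` times the cyclic sum of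
`(Xτ) g(Y, Z)`. -/
def IsGrayManifold (g : Metric I M) : Prop :=
  ∀ X Y Z : Π x : M, TangentSpace I x, IsSmoothField X → IsSmoothField Y → IsSmoothField Z →
    ∀ x : M,
      covDerivForm g X (ricciForm g) Y Z x + covDerivForm g Y (ricciForm g) Z X x
          + covDerivForm g Z (ricciForm g) X Y x
        = 2 / ((Module.finrank ℝ E : ℝ) + 2) *
          (d% (scalarCurvature g) x (X x) * g.inner x (Y x) (Z x)
            + d% (scalarCurvature g) x (Y x) * g.inner x (Z x) (X x)
            + d% (scalarCurvature g) x (Z x) * g.inner x (X x) (Y x))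

/-! ### Killing fields and Killing tensors -/

/-- `ξ` is a Killing vector field: it is smooth and the Lie derivative `L_ξ g` vanishes, that is
`ξ(g(X, Y)) = g([ξ, X], Y) + g(X, [ξ, Y])` for all vector fields `X`, `Y`. -/
def IsKillingField (g : Metric I M) (ξ : Π x : M, TangentSpace I x) : Prop :=
  IsSmoothField ξ ∧
    ∀ X Y : Π x : M, TangentSpace I x, IsSmoothField X → IsSmoothField Y → ∀ x : M,
      d% (fun y => g.inner y (X y) (Y y)) x (ξ x)
        = g.inner x (VectorField.mlieBracket I ξ X x) (Y x)
          + g.inner x (X x) (VectorField.mlieBracket I ξ Y x)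

/-- `S` is a Killing tensor: it is a smooth (1,1) tensor with `g((∇_X S) X, X) = 0` for all `X`. -/
def IsKillingTensor (g : Metric I M)
    (S : Π x : M, TangentSpace I x →ₗ[ℝ] TangentSpace I x) : Prop :=
  IsSmoothEndo S ∧
    ∀ X : Π x : M, TangentSpace I x, IsSmoothField X → ∀ x : M,
      g.inner x (covDerivEndo g X S X x) (X x) = 0

/-! ### Hermitian structures -/

/-- `J` is a Hermitian complex structure on the Riemannian manifold `(M, g)`: a smooth orthogonal
almost complex structure which is integrable, that is, whose Nijenhuis tensor vanishes. -/
structure IsHermitianStructure (g : Metric I M)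
    (J : Π x : M, TangentSpace I x →ₗ[ℝ] TangentSpace I x) : Prop where
  smooth : IsSmoothEndo J
  sq : ∀ (x : M) (v : TangentSpace I x), J x (J x v) = -v
  orthogonal : ∀ (x : M) (v w : TangentSpace I x), g.inner x (J x v) (J x w) = g.inner x v w
  integrable : ∀ X Y : Π x : M, TangentSpace I x, IsSmoothField X → IsSmoothField Y → ∀ x : M,
    VectorField.mlieBracket I (fun y => J y (X y)) (fun y => J y (Y y)) x
      - J x (VectorField.mlieBracket I (fun y => J y (X y)) Y x)
      - J x (VectorField.mlieBracket I X (fun y => J y (Y y)) x)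
      - VectorField.mlieBracket I X Y x = 0

/-- `o` is the orientation which the complex structure `J` induces on a real vector space of
dimension four: the bases `(u, Ju, v, Jv)` are positively oriented. -/
def InducesOrientation {V : Type*} [AddCommGroup V] [Module ℝ V] (J : V →ₗ[ℝ] V)
    (o : Orientation ℝ V (Fin 4)) : Prop :=
  ∀ b : Module.Basis (Fin 4) ℝ V, b 1 = J (b 0) → b 3 = J (b 2) → b.orientation = o

/-- The complex structures `J` and `J'` on a real vector space of dimension four induce opposite
orientations. -/
def InduceOppositeOrientations {V : Type*} [AddCommGroup V] [Module ℝ V] (J J' : V →ₗ[ℝ] V) :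
    Prop :=
  ∃ o : Orientation ℝ V (Fin 4), InducesOrientation J o ∧ InducesOrientation J' (-o)

/-! ### Irreducibility -/

/-- `D` is a smooth distribution, that is, a smooth subbundle of the tangent bundle: near every
point it has a smooth frame. -/
def IsSmoothDistribution (D : Π x : M, Submodule ℝ (TangentSpace I x)) : Prop :=
  ∀ x : M, ∃ U : Set M, IsOpen U ∧ x ∈ U ∧
    ∃ (k : ℕ) (s : Fin k → Π y : M, TangentSpace I y),
      (∀ i, CMDiff[U] ∞ (T% (s i))) ∧
      ∀ y ∈ U, LinearIndependent ℝ (fun i => s i y) ∧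
        Submodule.span ℝ (Set.range fun i => s i y) = D y

/-- The distribution `D` is parallel: `∇_X Y` is a section of `D` for every section `Y` of `D`. -/
def IsParallelDistribution (g : Metric I M) (D : Π x : M, Submodule ℝ (TangentSpace I x)) : Prop :=
  ∀ X Y : Π x : M, TangentSpace I x, IsSmoothField X → IsSmoothField Y →
    (∀ x, Y x ∈ D x) → ∀ x, covDeriv g X Y x ∈ D x

/-- The Riemannian manifold `(M, g)` is irreducible: the only parallel smooth distributions are the
zero distribution and the whole tangent bundle. -/
def IsIrreducible (g : Metric I M) : Prop :=
  ∀ D : Π x : M, Submodule ℝ (TangentSpace I x), IsSmoothDistribution D →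
    IsParallelDistribution g D → (∀ x, D x = ⊥) ∨ (∀ x, D x = ⊤)

end General

/-! ### Bi-Hermitian Gray surfaces -/

section Surface

variable {M : Type*} [TopologicalSpace M] [ChartedSpace (EuclideanSpace ℝ (Fin 4)) M]
  [IsManifold (𝓡 4) ∞ M]

/-- `(M, g, J, J')` is a bi-Hermitian Gray surface: an irreducible Riemannian manifold of dimension
four, whose Ricci tensor satisfies Gray's condition, with two Hermitian complex structures of
opposite orientation which commute with the Ricci tensor. -/
structure IsBiHermitianGraySurface (g : Metric (𝓡 4) M)
    (J J' : Π x : M, TangentSpace (𝓡 4) x →ₗ[ℝ] TangentSpace (𝓡 4) x) : Prop where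
  irreducible : IsIrreducible g
  gray : IsGrayManifold g
  hermitian : IsHermitianStructure g J
  hermitian' : IsHermitianStructure g J'
  opposite : ∀ x, InduceOppositeOrientations (J x) (J' x)
  commute : ∀ x v, ricciEndo g x (J x v) = J x (ricciEndo g x v)
  commute' : ∀ x v, ricciEndo g x (J' x v) = J' x (ricciEndo g x v)

/-- The tensor `S₀ = Ric - (τ / 3) Id`, so that `ρ(u, v) = g(S₀ u, v) + (τ / 3) g(u, v)`. -/
noncomputable def ricciKillingTensor (g : Metric (𝓡 4) M) (x : M) :
    TangentSpace (𝓡 4) x →ₗ[ℝ] TangentSpace (𝓡 4) x :=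
  ricciEndo g x - (scalarCurvature g x / 3) • LinearMap.id

end Surface

end BiHermitian

/-! Write `S = Ric`, `S₀ = S - (τ/3) Id` and `T = ∇ξ`, a skew endomorphism because `ξ` is Killing.
With three equal arguments Gray's condition in dimension 4 reads `(∇_X ρ)(X, X) = (1/3)(Xτ) g(X,
X)`, which says exactly that `S₀` is a Killing tensor.

For the second claim, a Killing field preserves the connection, hence the curvature, `ρ`, `S` and
`τ`. Since the connection is torsion-free, `L_ξ S = 0` becomes `∇_ξ S = [T, S]`
(`IsKillingField.covDeriv_ricciEndo`). As `J` and `J'` commute with `S` and are parallel along `ξ`,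
they commute with `∇_ξ S`, hence with `[T, S]` (`IsKillingField.commutator_comm`).

The rest is algebra in one tangent space (`commutator_eq_zero`). If `S` is not scalar, it has two
eigenplanes, each preserved by `J` and `J'`, and on each plane `J' = ±J`. The orientations are
opposite, so the two signs differ. Thus `K = J J'` is an involution equal to `1` on one plane and
`-1` on the other, and `S` is a combination of `Id` and `K`. Therefore `[T, S]` is a multiple of
`[T, K]`, which anticommutes with `K`; but it also commutes with `K`, so it is zero.

Hence `∇_ξ S = 0` and `T` commutes with `S`. Gray's condition on `(X, X, ξ)` then loses its
`ξ`-derivatives and gives `g((∇_X S₀) ξ, X) = 0`. Since `S₀ T` is skew as well, `g(∇_X (S₀ ξ), X) =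
0`, which is the Killing equation (`IsGrayManifold.isKillingField`).

The analysis is done with fields smooth near a point: this class is stable under the connection and
the bracket, so second derivatives can be taken, and it contains local frames and local extensions
of vectors. -/

open Filter Topology

namespace BiHermitian

/-! ### Germs of smooth fields and functions, local frames, the Lie bracket. -/

section Germs

variable {E : Type*} [NormedAddCommGroup E] [NormedSpace ℝ E] [FiniteDimensional ℝ E]
  {H : Type*} [TopologicalSpace H] {I : ModelWithCorners ℝ E H}
  {M : Type*} [TopologicalSpace M] [ChartedSpace H M] [IsManifold I ∞ M]

/-! ### Vector fields and functions which are smooth near a point -/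

/-- The vector field `X` is smooth at all points near `x`. -/
def SmoothNear (X : Π y : M, TangentSpace I y) (x : M) : Prop :=
  ∀ᶠ y in 𝓝 x, CMDiffAt ∞ (T% X) y

variable (I) in
/-- The function `f` is smooth at all points near `x`. -/
def SmoothFunNear (f : M → ℝ) (x : M) : Prop :=
  ∀ᶠ y in 𝓝 x, ContMDiffAt I 𝓘(ℝ, ℝ) ∞ f y

variable {X Y Z : Π y : M, TangentSpace I y} {f h : M → ℝ} {x : M}

omit [FiniteDimensional ℝ E] in
lemma IsSmoothField.smoothNear (hX : IsSmoothField X) (x : M) : SmoothNear X x :=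
  Eventually.of_forall fun y => hX y

omit [FiniteDimensional ℝ E] in
lemma SmoothNear.eventually (hX : SmoothNear X x) : ∀ᶠ y in 𝓝 x, SmoothNear X y :=
  eventually_eventually_nhds.mpr hX

omit [FiniteDimensional ℝ E] in
lemma SmoothNear.contMDiffAt (hX : SmoothNear X x) : CMDiffAt ∞ (T% X) x :=
  hX.self_of_nhds

omit [FiniteDimensional ℝ E] in
lemma SmoothNear.mdifferentiableAt (hX : SmoothNear X x) : MDiffAt (T% X) x :=
  hX.contMDiffAt.mdifferentiableAt (by simp)

omit [FiniteDimensional ℝ E] in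
lemma SmoothNear.congr (hX : SmoothNear X x) (hY : Y =ᶠ[𝓝 x] X) : SmoothNear Y x := by
  filter_upwards [hX, hY.eventuallyEq_nhds] with y hy hy'
  refine hy.congr_of_eventuallyEq ?_
  filter_upwards [hy'] with z hz
  rw [hz]

omit [FiniteDimensional ℝ E] [IsManifold I ∞ M] in
lemma SmoothFunNear.eventually (hf : SmoothFunNear I f x) : ∀ᶠ y in 𝓝 x, SmoothFunNear I f y :=
  eventually_eventually_nhds.mpr hf

omit [FiniteDimensional ℝ E] [IsManifold I ∞ M] in
lemma SmoothFunNear.contMDiffAt (hf : SmoothFunNear I f x) : ContMDiffAt I 𝓘(ℝ, ℝ) ∞ f x :=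
  hf.self_of_nhds

omit [FiniteDimensional ℝ E] [IsManifold I ∞ M] in
lemma SmoothFunNear.mdifferentiableAt (hf : SmoothFunNear I f x) : MDiffAt f x :=
  hf.contMDiffAt.mdifferentiableAt (by simp)

omit [FiniteDimensional ℝ E] [IsManifold I ∞ M] in
lemma SmoothFunNear.congr (hf : SmoothFunNear I f x) (hh : h =ᶠ[𝓝 x] f) :
    SmoothFunNear I h x := by
  filter_upwards [hf, hh.eventuallyEq_nhds] with y hy hy'
  exact hy.congr_of_eventuallyEq hy'

omit [FiniteDimensional ℝ E] [IsManifold I ∞ M] in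
lemma mvfderiv_congr (hfh : f =ᶠ[𝓝 x] h) : d% f x = d% h x := by
  ext v
  have := hfh.mfderiv_eq (I := I) (I' := 𝓘(ℝ, ℝ))
  simp only [mvfderiv]
  exact congr($this v)

omit [FiniteDimensional ℝ E] in
lemma SmoothNear.add (hX : SmoothNear X x) (hY : SmoothNear Y x) : SmoothNear (X + Y) x := by
  filter_upwards [hX, hY] with y h1 h2
  exact h1.add_section h2

omit [FiniteDimensional ℝ E] in
lemma SmoothNear.sub (hX : SmoothNear X x) (hY : SmoothNear Y x) : SmoothNear (X - Y) x := by
  filter_upwards [hX, hY] with y h1 h2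
  exact h1.sub_section h2

omit [FiniteDimensional ℝ E] in
lemma SmoothNear.smul (hf : SmoothFunNear I f x) (hX : SmoothNear X x) :
    SmoothNear (f • X) x := by
  filter_upwards [hf, hX] with y h1 h2
  exact h1.smul_section h2

omit [FiniteDimensional ℝ E] in
lemma SmoothNear.sum {ι : Type*} {s : Finset ι} {X : ι → Π y : M, TangentSpace I y}
    (hX : ∀ i ∈ s, SmoothNear (X i) x) : SmoothNear (fun y => ∑ i ∈ s, X i y) x := by
  filter_upwards [(eventually_all_finset s).mpr hX] with y hy
  exact ContMDiffAt.sum_section hy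

omit [FiniteDimensional ℝ E] in
/-- Every tangent vector is the value of a vector field which is smooth near its base point. -/
lemma smoothNear_extend (v : TangentSpace I x) :
    SmoothNear (FiberBundle.extend E v : Π y : M, TangentSpace I y) x := by
  obtain ⟨s, hs, h⟩ := FiberBundle.exists_contMDiffOn_extend (k := ∞) I E v
  filter_upwards [eventually_mem_nhds_iff.mpr hs] with y hy
  exact h.contMDiffAt hy

lemma SmoothNear.mlieBracket (hX : SmoothNear X x) (hY : SmoothNear Y x) :
    SmoothNear (VectorField.mlieBracket I X Y) x := by
  filter_upwards [hX, hY] with y h1 h2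
  have : IsManifold I (((⊤ : ℕ∞) : ℕ∞ω) + 1) M := by simpa
  have : IsManifold I (minSmoothness ℝ 2) M := by simp; infer_instance
  exact ContMDiffAt.mlieBracket_vectorField (n := ⊤) (m := ⊤) h1 h2 (by simp)

/-- The Jacobi identity. -/
lemma mlieBracket_mlieBracket (hX : SmoothNear X x) (hY : SmoothNear Y x) (hZ : SmoothNear Z x) :
    VectorField.mlieBracket I X (VectorField.mlieBracket I Y Z) x =
      VectorField.mlieBracket I (VectorField.mlieBracket I X Y) Z x +
        VectorField.mlieBracket I Y (VectorField.mlieBracket I X Z) x := by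
  have : IsManifold I (minSmoothness ℝ 3) M := by simp; infer_instance
  have h2 : (2 : ℕ∞ω) ≤ ∞ := ENat.LEInfty.out
  exact VectorField.leibniz_identity_mlieBracket_apply (hX.contMDiffAt.of_le (by simpa))
    (hY.contMDiffAt.of_le (by simpa)) (hZ.contMDiffAt.of_le (by simpa))

/-! ### Local frames -/

/-- The local frame of the tangent bundle near `x` given by the preferred trivialization. -/
noncomputable def localFrameAt (x : M) (i : Fin (Module.finrank ℝ E)) : Π y : M, TangentSpace I y :=
  (trivializationAt E (TangentSpace I : M → Type _) x).localFrame (Module.finBasis ℝ E) i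

/-- The coefficients with respect to the local frame `localFrameAt x`. -/
noncomputable def localCoframeAt (x : M) (i : Fin (Module.finrank ℝ E)) (y : M) :
    TangentSpace I y →ₗ[ℝ] ℝ :=
  (trivializationAt E (TangentSpace I : M → Type _) x).localFrameCoeff I (Module.finBasis ℝ E) i y

omit [FiniteDimensional ℝ E] in
lemma eventually_mem_baseSet (x : M) :
    ∀ᶠ y in 𝓝 x, y ∈ (trivializationAt E (TangentSpace I : M → Type _) x).baseSet :=
  (trivializationAt E (TangentSpace I : M → Type _) x).open_baseSet.mem_nhds
    (FiberBundle.mem_baseSet_trivializationAt' x)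

lemma smoothNear_localFrameAt (x : M) (i : Fin (Module.finrank ℝ E)) :
    SmoothNear (localFrameAt x i : Π y : M, TangentSpace I y) x := by
  filter_upwards [eventually_mem_baseSet (I := I) x] with y hy
  exact contMDiffAt_localFrame_of_mem ∞ _ _ i hy

lemma smoothNear_iff_localCoframeAt :
    SmoothNear X x ↔ ∀ i, SmoothFunNear I (fun y => localCoframeAt x i y (X y)) x := by
  simp only [SmoothFunNear]
  rw [← eventually_all]
  refine eventually_congr ?_
  filter_upwards [eventually_mem_baseSet (I := I) x] with y hy
  exact contMDiffAt_iff_localFrameCoeff _ hy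

lemma eventually_exists_basis (x : M) :
    ∀ᶠ y in 𝓝 x, ∃ b : Module.Basis (Fin (Module.finrank ℝ E)) ℝ (TangentSpace I y),
      ∀ i, b i = localFrameAt x i y ∧ b.coord i = localCoframeAt x i y := by
  filter_upwards [eventually_mem_baseSet (I := I) x] with y hy
  refine ⟨(trivializationAt E (TangentSpace I : M → Type _) x).basisAt (Module.finBasis ℝ E) hy,
    fun i => ⟨?_, ?_⟩⟩
  · exact (Trivialization.localFrame_apply_of_mem_baseSet _ _ hy).symm
  · ext v
    have := (trivializationAt E (TangentSpace I : M → Type _) x).localFrameCoeff_apply_of_mem_baseSet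
      (I := I) (Module.finBasis ℝ E) hy (FiberBundle.extend E v) i
    rw [FiberBundle.extend_apply_self] at this
    simp [localCoframeAt, this]

lemma eventually_eq_sum_localFrameAt (X : Π y : M, TangentSpace I y) (x : M) :
    ∀ᶠ y in 𝓝 x, X y = ∑ i, localCoframeAt x i y (X y) • localFrameAt x i y := by
  filter_upwards [eventually_exists_basis (I := I) x] with y ⟨b, hb⟩
  conv_lhs => rw [← b.sum_repr (X y)]
  exact Finset.sum_congr rfl fun i _ => by rw [← (hb i).1, ← (hb i).2]; rfl

/-! ### Differentiation along vector fields -/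

/-- For a frame field `Z`, the smooth field `[X, fZ] - f [X, Z]` equals `(Xf) Z`, so `Xf` is one of
its frame coefficients. In dimension zero there is no frame field, but `X` vanishes. -/
lemma SmoothFunNear.mvfderiv_apply (hf : SmoothFunNear I f x) (hX : SmoothNear X x) :
    SmoothFunNear I (fun y => d% f y (X y)) x := by
  rcases isEmpty_or_nonempty (Fin (Module.finrank ℝ E)) with he | ⟨⟨i⟩⟩
  · have : (fun y => d% f y (X y)) = fun _ => (0 : ℝ) := by
      ext y
      have : X y = 0 := (tangentBasis y).ext_elem fun i => he.elim i
      rw [this, map_zero]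
    rw [this]
    exact Eventually.of_forall fun y => contMDiffAt_const
  have hZ := smoothNear_localFrameAt (I := I) x i
  set Z : Π y : M, TangentSpace I y := localFrameAt x i with hZ'
  have h1 := (hX.mlieBracket (SmoothNear.smul hf hZ)).sub (SmoothNear.smul hf (hX.mlieBracket hZ))
  refine SmoothFunNear.congr (smoothNear_iff_localCoframeAt.mp h1 i) ?_
  filter_upwards [hf, hZ, eventually_exists_basis (I := I) x] with y h2 h3 ⟨b, hb⟩
  have h5 : VectorField.mlieBracket I X (f • Z) y =
      d% f y (X y) • Z y + f y • VectorField.mlieBracket I X Z y :=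
    VectorField.mlieBracket_smul_right (h2.mdifferentiableAt (by simp))
      (h3.mdifferentiableAt (by simp))
  have h6 : localCoframeAt x i y (Z y) = 1 := by
    rw [← (hb i).2, hZ', ← (hb i).1]; simp
  simp [h5, h6]

/-- The Lie bracket is the commutator of derivations. -/
lemma mvfderiv_mlieBracket (hf : SmoothFunNear I f x) (hX : SmoothNear X x)
    (hY : SmoothNear Y x) :
    d% f x (VectorField.mlieBracket I X Y x) =
      d% (fun y => d% f y (Y y)) x (X x) - d% (fun y => d% f y (X y)) x (Y x) := by
  -- The identity is read off from the Jacobi identity for `X`, `Y`, `fZ`: once the Jacobi identity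
  -- for `X`, `Y`, `Z` is subtracted, only a multiple of `Z x` survives. A nonzero value of `Z` is
  -- needed to cancel it.
  by_cases hv : ∃ v : TangentSpace I x, v ≠ 0
  swap
  · push Not at hv
    rw [hv (VectorField.mlieBracket I X Y x), hv (X x), hv (Y x)]
    simp
  obtain ⟨v, hv⟩ := hv
  have hZ := smoothNear_extend v
  have hZv : FiberBundle.extend E v x = v := FiberBundle.extend_apply_self ..
  generalize (FiberBundle.extend E v : Π y : M, TangentSpace I y) = Z at hZ hZv
  have key : ∀ {X : Π y : M, TangentSpace I y} {g : M → ℝ} {Z : Π y : M, TangentSpace I y},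
      SmoothFunNear I g x → SmoothNear Z x →
      VectorField.mlieBracket I X (g • Z) =ᶠ[𝓝 x]
        (fun y => d% g y (X y)) • Z + g • VectorField.mlieBracket I X Z := by
    intro X g Z hg hZ
    filter_upwards [hg, hZ] with y h2 h3
    exact VectorField.mlieBracket_smul_right (h2.mdifferentiableAt (by simp))
      (h3.mdifferentiableAt (by simp))
  have hYf := hf.mvfderiv_apply hY
  have hXf := hf.mvfderiv_apply hX
  have e : ∀ {X Y : Π y : M, TangentSpace I y}, SmoothNear X x → SmoothNear Y x →
      VectorField.mlieBracket I X (VectorField.mlieBracket I Y (f • Z)) x =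
      d% (fun y => d% f y (Y y)) x (X x) • Z x +
        d% f x (Y x) • VectorField.mlieBracket I X Z x +
        (d% f x (X x) • VectorField.mlieBracket I Y Z x +
          f x • VectorField.mlieBracket I X (VectorField.mlieBracket I Y Z) x) := by
    intro X Y hX hY
    refine (EventuallyEq.mlieBracket_vectorField_eq (EventuallyEq.refl _ X) (key hf hZ)).trans ?_
    rw [VectorField.mlieBracket_add_right
        (SmoothNear.smul (hf.mvfderiv_apply hY) hZ).mdifferentiableAt
        (SmoothNear.smul hf (hY.mlieBracket hZ)).mdifferentiableAt,
      (key (hf.mvfderiv_apply hY) hZ).self_of_nhds,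
      (key hf (hY.mlieBracket hZ)).self_of_nhds]
    rfl
  have h1 := mlieBracket_mlieBracket hX hY (SmoothNear.smul hf hZ)
  rw [e hX hY, e hY hX, (key hf hZ).self_of_nhds, mlieBracket_mlieBracket hX hY hZ] at h1
  simp only [Pi.add_apply, Pi.smul_apply', hZv] at h1
  have h2 : (d% f x (VectorField.mlieBracket I X Y x) -
      (d% (fun y => d% f y (Y y)) x (X x) - d% (fun y => d% f y (X y)) x (Y x))) • v = 0 := by
    rw [← sub_eq_zero] at h1
    rw [← neg_eq_zero, ← h1]
    module
  exact sub_eq_zero.mp ((smul_eq_zero.mp h2).resolve_right hv)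

/-! ### Smoothness and the metric -/

omit [FiniteDimensional ℝ E] in
lemma SmoothNear.inner (g : Metric I M) (hX : SmoothNear X x) (hY : SmoothNear Y x) :
    SmoothFunNear I (fun y => g.inner y (X y) (Y y)) x := by
  filter_upwards [hX, hY] with y h1 h2
  have h : ContMDiffAt I (I.prod 𝓘(ℝ, ℝ)) ∞
      (fun y => TotalSpace.mk' ℝ (E := Bundle.Trivial M ℝ) y (g.inner y (X y) (Y y))) y :=
    ContMDiffAt.clm_bundle_apply₂ (F₁ := E) (F₂ := E) g.contMDiff.contMDiffAt h1 h2
  rw [contMDiffAt_totalSpace] at h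
  exact h.2

omit [FiniteDimensional ℝ E] [IsManifold I ∞ M] in
lemma SmoothFunNear.det {n : Type*} [Fintype n] [DecidableEq n] {A : M → Matrix n n ℝ}
    (hA : ∀ i j, SmoothFunNear I (fun y => A y i j) x) :
    SmoothFunNear I (fun y => (A y).det) x := by
  simp only [SmoothFunNear] at hA
  simp only [← eventually_all] at hA
  filter_upwards [hA] with y hy
  simp only [Matrix.det_apply]
  refine ContMDiffAt.sum fun σ _ => ?_
  have : ContMDiffAt I 𝓘(ℝ, ℝ) ∞ (fun z => ∏ i, A z (σ i) i) y :=
    ContMDiffAt.prod fun i _ => hy _ _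
  exact (contMDiffAt_const (c := ((Equiv.Perm.sign σ : ℤ) : ℝ))).mul this |>.congr_of_eventuallyEq
    (Eventually.of_forall fun z => by simp [Units.smul_def])

/-- A vector field is smooth if its inner products with smooth vector fields are smooth. -/
lemma SmoothNear.of_inner (g : Metric I M)
    (h : ∀ Z : Π y : M, TangentSpace I y, SmoothNear Z x →
      SmoothFunNear I (fun y => g.inner y (X y) (Z y)) x) : SmoothNear X x := by
  rw [smoothNear_iff_localCoframeAt]
  intro i
  -- Cramer's rule: the coefficients of `X` solve the linear system with the Gram matrix `G` of the
  -- frame and right-hand side `w`, so each one is a quotient of determinants with smooth entries.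
  let G : M → Matrix (Fin (Module.finrank ℝ E)) (Fin (Module.finrank ℝ E)) ℝ := fun y =>
    Matrix.of fun j k => g.inner y (localFrameAt x k y) (localFrameAt x j y)
  let w : M → Fin (Module.finrank ℝ E) → ℝ := fun y j => g.inner y (X y) (localFrameAt x j y)
  have hG : ∀ j k, SmoothFunNear I (fun y => G y j k) x := fun j k =>
    (smoothNear_localFrameAt x k).inner g (smoothNear_localFrameAt x j)
  have hG' : SmoothFunNear I (fun y => ((G y).updateCol i (w y)).det) x := by
    refine SmoothFunNear.det fun j k => ?_
    by_cases hk : k = i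
    · subst hk
      simpa using h _ (smoothNear_localFrameAt x j)
    · simpa [Matrix.updateCol_ne hk] using hG j k
  have hev : ∀ᶠ y in 𝓝 x, (G y).det ≠ 0 ∧
      localCoframeAt x i y (X y) = ((G y).updateCol i (w y)).det / (G y).det := by
    filter_upwards [eventually_exists_basis (I := I) x] with y ⟨b, hb⟩
    have h1 : ∀ v : TangentSpace I y, (G y).mulVec (fun k => b.coord k v) =
        fun j => g.inner y v (localFrameAt x j y) := by
      intro v
      ext j
      conv_rhs => rw [← b.sum_repr v]
      simp only [Matrix.mulVec, dotProduct, map_sum, map_smul, sum_apply,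
        smul_apply, smul_eq_mul, G, Matrix.of_apply]
      exact Finset.sum_congr rfl fun k _ => by rw [(hb k).1, mul_comm]; rfl
    -- A kernel vector of the Gram matrix would give a nonzero tangent vector orthogonal to the
    -- whole frame, hence to itself.
    have h2 : (G y).det ≠ 0 := by
      intro h0
      obtain ⟨c, hc, hc'⟩ := Matrix.exists_mulVec_eq_zero_iff.mpr h0
      let v := ∑ k, c k • b k
      have hv : (fun k => b.coord k v) = c := by
        ext k
        simp [v, Finsupp.single_apply]
      have hv0 : v ≠ 0 := by
        intro h
        apply hc
        rw [← hv, h]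
        ext; simp
      rw [← hv, h1] at hc'
      refine (g.pos y v hv0).ne' ?_
      conv_lhs => enter [2]; rw [← b.sum_repr v]
      rw [map_sum]
      refine Finset.sum_eq_zero fun k _ => ?_
      rw [map_smul, (hb k).1]
      simp [congrFun hc' k]
    refine ⟨h2, ?_⟩
    rw [eq_div_iff h2, ← Matrix.cramer_apply, ← (hb i).2]
    have h3 := congrArg (G y).adjugate.mulVec (h1 (X y))
    rw [Matrix.mulVec_mulVec, Matrix.adjugate_mul, Matrix.smul_mulVec, Matrix.one_mulVec] at h3
    have h4 := congrFun h3 i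
    rw [Matrix.cramer_eq_adjugate_mulVec]
    simpa [mul_comm] using h4
  refine SmoothFunNear.congr (f := fun y => ((G y).updateCol i (w y)).det / (G y).det) ?_
    (hev.mono fun y hy => hy.2)
  filter_upwards [hev, hG', SmoothFunNear.det hG] with y h1 h2 h3
  exact h2.div₀ h3 h1.1

lemma ext_inner {g : Metric I M} {v w : TangentSpace I x}
    (h : ∀ u, g.inner x v u = g.inner x w u) : v = w :=
  (flat g x).injective (LinearMap.ext h)

end Germs

/-! ### The Levi-Civita connection on germs, tensoriality, curvature and the Ricci tensor. -/

section Connection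

variable {E : Type*} [NormedAddCommGroup E] [NormedSpace ℝ E] [FiniteDimensional ℝ E]
  {H : Type*} [TopologicalSpace H] {I : ModelWithCorners ℝ E H}
  {M : Type*} [TopologicalSpace M] [ChartedSpace H M] [IsManifold I ∞ M]
  {g : Metric I M} {X Y Z W X' Y' Z' : Π y : M, TangentSpace I y} {f : M → ℝ} {x : M}

/-! ### Calculus with the Levi-Civita connection -/

/-- Pairing with a smooth field gives half the Koszul expression, whose six terms are smooth;
`SmoothNear.of_inner` then applies. -/
lemma SmoothNear.covDeriv (hX : SmoothNear X x) (hY : SmoothNear Y x) :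
    SmoothNear (covDeriv g X Y) x := by
  refine SmoothNear.of_inner g fun Z hZ => ?_
  have h1 := (hY.inner g hZ).mvfderiv_apply hX
  have h2 := (hZ.inner g hX).mvfderiv_apply hY
  have h3 := (hX.inner g hY).mvfderiv_apply hZ
  have h4 := (hX.mlieBracket hY).inner g hZ
  have h5 := (hY.mlieBracket hZ).inner g hX
  have h6 := (hZ.mlieBracket hX).inner g hY
  have h : SmoothFunNear I (fun y => (1 / 2 : ℝ) * koszul g X Y Z y) x := by
    filter_upwards [h1, h2, h3, h4, h5, h6] with y h1 h2 h3 h4 h5 h6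
    exact contMDiffAt_const.mul (((((h1.add h2).sub h3).add h4).sub h5).add h6)
  refine h.congr ?_
  filter_upwards [hX.eventually, hY.eventually, hZ.eventually] with y hX hY hZ
  have := two_mul_inner_leviCivita g hX.mdifferentiableAt hY.mdifferentiableAt
    hZ.mdifferentiableAt
  rw [BiHermitian.covDeriv, ← this]
  ring

lemma covDeriv_congr (hX : X x = X' x) (hY : SmoothNear Y x)
    (hYY' : Y' =ᶠ[𝓝 x] Y) :
    covDeriv g X Y x = covDeriv g X' Y' x := by
  have := (leviCivita g).isCovariantDerivativeOnUniv.congr_of_eventuallyEq hY.mdifferentiableAt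
    (hY.congr hYY').mdifferentiableAt univ_mem (hYY'.mono fun _ h => h.symm)
  change (leviCivita g).toFun Y x (X x) = (leviCivita g).toFun Y' x (X' x)
  rw [this, hX]

lemma covDeriv_add_left : covDeriv g (X + X') Y x = covDeriv g X Y x + covDeriv g X' Y x :=
  map_add _ _ _

lemma covDeriv_smul_left : covDeriv g (f • X) Y x = f x • covDeriv g X Y x :=
  map_smul _ _ _

lemma covDeriv_add_right (hY : SmoothNear Y x) (hY' : SmoothNear Y' x) :
    covDeriv g X (Y + Y') x = covDeriv g X Y x + covDeriv g X Y' x :=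
  congr($((leviCivita g).isCovariantDerivativeOnUniv.add hY.mdifferentiableAt
    hY'.mdifferentiableAt) (X x))

lemma covDeriv_smul_right (hf : SmoothFunNear I f x) (hY : SmoothNear Y x) :
    covDeriv g X (f • Y) x = f x • covDeriv g X Y x + d% f x (X x) • Y x :=
  congr($((leviCivita g).isCovariantDerivativeOnUniv.leibniz hY.mdifferentiableAt
    hf.mdifferentiableAt) (X x))

lemma covDeriv_sub_right (hY : SmoothNear Y x) (hY' : SmoothNear Y' x) :
    covDeriv g X (Y - Y') x = covDeriv g X Y x - covDeriv g X Y' x := by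
  rw [eq_sub_iff_add_eq, ← covDeriv_add_right (hY.sub hY') hY', sub_add_cancel]

lemma mlieBracket_eq (g : Metric I M) (hX : SmoothNear X x) (hY : SmoothNear Y x) :
    VectorField.mlieBracket I X Y x = covDeriv g X Y x - covDeriv g Y X x :=
  ((CovariantDerivative.torsion_eq_zero_iff _).mp (leviCivita_torsion g) hX.mdifferentiableAt
    hY.mdifferentiableAt).symm

lemma mvfderiv_inner (hX : SmoothNear X x) (hY : SmoothNear Y x) (hZ : SmoothNear Z x) :
    d% (fun y => g.inner y (Y y) (Z y)) x (X x) =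
      g.inner x (covDeriv g X Y x) (Z x) + g.inner x (Y x) (covDeriv g X Z x) :=
  leviCivita_metric g hX.mdifferentiableAt hY.mdifferentiableAt hZ.mdifferentiableAt

/-! ### Operations which are tensorial on smooth vector fields -/

variable (I) in
/-- An operation on vector fields smooth near `x` which is linear over the smooth functions. -/
structure SmoothTensorialAt {A : Type*} [AddCommGroup A] [Module ℝ A]
    (Φ : (Π y : M, TangentSpace I y) → A) (x : M) : Prop where
  add : ∀ {X Y}, SmoothNear X x → SmoothNear Y x → Φ (X + Y) = Φ X + Φ Y
  smul : ∀ {f X}, SmoothFunNear I f x → SmoothNear X x → Φ (f • X) = f x • Φ X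

variable {A : Type*} [AddCommGroup A] [Module ℝ A] {Φ : (Π y : M, TangentSpace I y) → A}

omit [FiniteDimensional ℝ E] in
-- No bump function is needed: the indicator `ψ` of the set where `X = Y` is constant near `x`, and
-- `ψ • Y = ψ • X` holds everywhere.
lemma SmoothTensorialAt.congr_of_eventuallyEq (hΦ : SmoothTensorialAt I Φ x)
    (hX : SmoothNear X x) (hXY : Y =ᶠ[𝓝 x] X) : Φ Y = Φ X := by
  classical
  let ψ : M → ℝ := fun y => if X y = Y y then 1 else 0
  have hψx : ψ x = 1 := by simp [ψ, hXY.self_of_nhds]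
  have hψ : SmoothFunNear I ψ x := by
    refine SmoothFunNear.congr (f := fun _ => 1) (Eventually.of_forall fun _ => contMDiffAt_const)
      (hXY.mono fun y hy => by simp [ψ, hy])
  have h : ψ • Y = ψ • X := by
    ext1 y
    simp only [Pi.smul_apply', ψ]
    split_ifs with h <;> simp [h]
  have h1 := hΦ.smul hψ (hX.congr hXY)
  rwa [h, hΦ.smul hψ hX, hψx, one_smul, one_smul, eq_comm] at h1

omit [FiniteDimensional ℝ E] in
lemma SmoothTensorialAt.zero (hΦ : SmoothTensorialAt I Φ x) : Φ 0 = 0 := by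
  have h0 : SmoothNear (0 : Π y : M, TangentSpace I y) x :=
    Eventually.of_forall fun y => contMDiff_zeroSection ℝ _ y
  have := hΦ.add h0 h0
  simpa using this

omit [FiniteDimensional ℝ E] in
lemma SmoothTensorialAt.sum (hΦ : SmoothTensorialAt I Φ x) {ι : Type*} (s : Finset ι)
    {X : ι → Π y : M, TangentSpace I y} (hX : ∀ i ∈ s, SmoothNear (X i) x) :
    Φ (fun y => ∑ i ∈ s, X i y) = ∑ i ∈ s, Φ (X i) := by
  classical
  induction s using Finset.induction_on with
  | empty => exact hΦ.zero
  | insert i s hi ih =>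
    rw [Finset.sum_insert hi, ← ih fun j hj => hX j (Finset.mem_insert_of_mem hj),
      ← hΦ.add (hX i (Finset.mem_insert_self i s))
        (SmoothNear.sum fun j hj => hX j (Finset.mem_insert_of_mem hj))]
    congr 1
    ext1 y
    simp [Finset.sum_insert hi]

/-- A tensorial operation depends only on the value of the vector field at `x`. -/
lemma SmoothTensorialAt.congr (hΦ : SmoothTensorialAt I Φ x)
    (hX : SmoothNear X x) (hY : SmoothNear Y x) (hXY : X x = Y x) : Φ X = Φ Y := by
  have key : ∀ {X : Π y : M, TangentSpace I y}, SmoothNear X x →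
      Φ X = ∑ i, localCoframeAt x i x (X x) • Φ (localFrameAt x i) := by
    intro X hX
    have hs : ∀ i ∈ Finset.univ, SmoothNear
        ((fun y => localCoframeAt x i y (X y)) • localFrameAt x i : Π y : M, TangentSpace I y) x :=
      fun i _ => SmoothNear.smul (smoothNear_iff_localCoframeAt.mp hX i)
        (smoothNear_localFrameAt x i)
    rw [hΦ.congr_of_eventuallyEq (SmoothNear.sum hs) (eventually_eq_sum_localFrameAt X x),
      hΦ.sum _ hs]
    exact Finset.sum_congr rfl fun i _ =>
      hΦ.smul (smoothNear_iff_localCoframeAt.mp hX i) (smoothNear_localFrameAt x i)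
  rw [key hX, key hY, hXY]

/-- The linear map on the tangent space defined by a tensorial operation. -/
noncomputable def SmoothTensorialAt.toLinearMap (hΦ : SmoothTensorialAt I Φ x) :
    TangentSpace I x →ₗ[ℝ] A where
  toFun v := Φ (FiberBundle.extend E v)
  map_add' v w := by
    rw [← hΦ.add (smoothNear_extend v) (smoothNear_extend w)]
    exact hΦ.congr (smoothNear_extend _) ((smoothNear_extend v).add (smoothNear_extend w))
      (by simp)
  map_smul' c v := by
    have hc : SmoothFunNear I (fun _ : M => c) x := Eventually.of_forall fun _ => contMDiffAt_const
    rw [RingHom.id_apply, ← hΦ.smul hc (smoothNear_extend v)]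
    exact hΦ.congr (smoothNear_extend _) (SmoothNear.smul hc (smoothNear_extend v)) (by simp)

/-! ### Curvature -/

lemma SmoothNear.curvature (hX : SmoothNear X x) (hY : SmoothNear Y x) (hZ : SmoothNear Z x) :
    SmoothNear (curvature g X Y Z) x :=
  ((hX.covDeriv (hY.covDeriv hZ)).sub (hY.covDeriv (hX.covDeriv hZ))).sub
    ((hX.mlieBracket hY).covDeriv hZ)

lemma curvature_swap (X Y Z : Π y : M, TangentSpace I y) (x : M) :
    curvature g X Y Z x = -curvature g Y X Z x := by
  have : covDeriv g (VectorField.mlieBracket I X Y) Z x =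
      -covDeriv g (VectorField.mlieBracket I Y X) Z x := by
    simp only [covDeriv]
    rw [VectorField.mlieBracket_swap_apply, map_neg]
  simp only [curvature, this]
  abel

/-- The term `(Yf) ∇_X Z` from `∇_Y (f ∇_X Z)` cancels against the one from `[fX, Y] = f [X, Y] -
(Yf) X`. -/
lemma smoothTensorialAt_curvature_left (hZ : SmoothNear Z x) :
    SmoothTensorialAt I (fun X => curvature g X Y Z x) x where
  add {X X'} hX hX' := by
    have e1 : covDeriv g Y (covDeriv g (X + X') Z) x =
        covDeriv g Y (covDeriv g X Z) x + covDeriv g Y (covDeriv g X' Z) x := by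
      rw [← covDeriv_add_right (hX.covDeriv hZ) (hX'.covDeriv hZ)]
      refine covDeriv_congr rfl ((hX.add hX').covDeriv hZ) (Eventually.of_forall fun y => ?_)
      exact covDeriv_add_left.symm
    have e2 : covDeriv g (VectorField.mlieBracket I (X + X') Y) Z x =
        covDeriv g (VectorField.mlieBracket I X Y) Z x +
          covDeriv g (VectorField.mlieBracket I X' Y) Z x := by
      simp only [covDeriv]
      rw [VectorField.mlieBracket_add_left hX.mdifferentiableAt hX'.mdifferentiableAt, map_add]
    simp only [curvature, covDeriv_add_left, e1, e2]
    abel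
  smul {f X} hf hX := by
    have e1 : covDeriv g Y (covDeriv g (f • X) Z) x =
        f x • covDeriv g Y (covDeriv g X Z) x + d% f x (Y x) • covDeriv g X Z x := by
      rw [← covDeriv_smul_right hf (hX.covDeriv hZ)]
      refine covDeriv_congr rfl ((SmoothNear.smul hf hX).covDeriv hZ)
        (Eventually.of_forall fun y => ?_)
      exact covDeriv_smul_left.symm
    have e2 : covDeriv g (VectorField.mlieBracket I (f • X) Y) Z x =
        -(d% f x (Y x) • covDeriv g X Z x) +
          f x • covDeriv g (VectorField.mlieBracket I X Y) Z x := by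
      simp only [covDeriv]
      rw [VectorField.mlieBracket_smul_left hf.mdifferentiableAt hX.mdifferentiableAt, map_add,
        map_smul, map_smul, neg_smul]
    simp only [curvature, covDeriv_smul_left, e1, e2]
    module

lemma smoothTensorialAt_curvature_middle (hZ : SmoothNear Z x) :
    SmoothTensorialAt I (fun Y => curvature g X Y Z x) x where
  add hY hY' := by
    rw [curvature_swap, (smoothTensorialAt_curvature_left hZ).add hY hY', curvature_swap X,
      curvature_swap X, neg_add]
  smul hf hY := by
    rw [curvature_swap, (smoothTensorialAt_curvature_left hZ).smul hf hY, curvature_swap X,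
      smul_neg]

/-- The first derivatives of `f` cancel by symmetry, and the second derivatives because `XYf - YXf =
[X, Y]f`. -/
lemma smoothTensorialAt_curvature_right (hX : SmoothNear X x) (hY : SmoothNear Y x) :
    SmoothTensorialAt I (fun Z => curvature g X Y Z x) x where
  add {Z Z'} hZ hZ' := by
    have e : ∀ {X Y : Π y : M, TangentSpace I y}, SmoothNear X x → SmoothNear Y x →
        covDeriv g X (covDeriv g Y (Z + Z')) x =
          covDeriv g X (covDeriv g Y Z) x + covDeriv g X (covDeriv g Y Z') x := by
      intro X Y hX hY
      rw [← covDeriv_add_right (hY.covDeriv hZ) (hY.covDeriv hZ')]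
      refine covDeriv_congr rfl (hY.covDeriv (hZ.add hZ')) ?_
      filter_upwards [hZ.eventually, hZ'.eventually] with y h h'
      exact (covDeriv_add_right h h').symm
    simp only [curvature, e hX hY, e hY hX, covDeriv_add_right hZ hZ']
    abel
  smul {f Z} hf hZ := by
    have e : ∀ {X Y : Π y : M, TangentSpace I y}, SmoothNear X x → SmoothNear Y x →
        covDeriv g X (covDeriv g Y (f • Z)) x =
          (f x • covDeriv g X (covDeriv g Y Z) x + d% f x (X x) • covDeriv g Y Z x) +
          (d% f x (Y x) • covDeriv g X Z x + d% (fun y => d% f y (Y y)) x (X x) • Z x) := by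
      intro X Y hX hY
      rw [← covDeriv_smul_right hf (hY.covDeriv hZ),
        ← covDeriv_smul_right (f := fun y => d% f y (Y y)) (hf.mvfderiv_apply hY) hZ,
        ← covDeriv_add_right (SmoothNear.smul hf (hY.covDeriv hZ))
          (SmoothNear.smul (hf.mvfderiv_apply hY) hZ)]
      refine covDeriv_congr rfl (hY.covDeriv (SmoothNear.smul hf hZ)) ?_
      filter_upwards [hf.eventually, hZ.eventually] with y h h'
      exact (covDeriv_smul_right h h').symm
    simp only [curvature, e hX hY, e hY hX, covDeriv_smul_right hf hZ,
      mvfderiv_mlieBracket hf hX hY]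
    module

/-- The curvature as a trilinear map: `curvatureAt g x u v w = R(u, v)w`. -/
noncomputable def curvatureAt (g : Metric I M) (x : M) :
    TangentSpace I x →ₗ[ℝ] TangentSpace I x →ₗ[ℝ] TangentSpace I x →ₗ[ℝ] TangentSpace I x :=
  LinearMap.mk₂ ℝ
    (fun u v => (smoothTensorialAt_curvature_right (g := g) (smoothNear_extend u)
      (smoothNear_extend v)).toLinearMap)
    (fun u u' v => by
      ext w
      exact (smoothTensorialAt_curvature_left (g := g) (Y := FiberBundle.extend E v)
        (smoothNear_extend w)).toLinearMap.map_add u u')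
    (fun c u v => by
      ext w
      exact (smoothTensorialAt_curvature_left (g := g) (Y := FiberBundle.extend E v)
        (smoothNear_extend w)).toLinearMap.map_smul c u)
    (fun u v v' => by
      ext w
      exact (smoothTensorialAt_curvature_middle (g := g) (X := FiberBundle.extend E u)
        (smoothNear_extend w)).toLinearMap.map_add v v')
    (fun c u v => by
      ext w
      exact (smoothTensorialAt_curvature_middle (g := g) (X := FiberBundle.extend E u)
        (smoothNear_extend w)).toLinearMap.map_smul c v)

lemma curvatureAt_apply (hX : SmoothNear X x) (hY : SmoothNear Y x) (hZ : SmoothNear Z x) :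
    curvatureAt g x (X x) (Y x) (Z x) = curvature g X Y Z x := by
  change curvature g (FiberBundle.extend E (X x)) (FiberBundle.extend E (Y x))
    (FiberBundle.extend E (Z x)) x = _
  rw [(smoothTensorialAt_curvature_left (smoothNear_extend _)).congr
      (smoothNear_extend _) hX (FiberBundle.extend_apply_self ..),
    (smoothTensorialAt_curvature_middle (smoothNear_extend _)).congr
      (smoothNear_extend _) hY (FiberBundle.extend_apply_self ..),
    (smoothTensorialAt_curvature_right hX hY).congr
      (smoothNear_extend _) hZ (FiberBundle.extend_apply_self ..)]

/-- The first Bianchi identity. -/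
lemma curvature_cyclic (hX : SmoothNear X x) (hY : SmoothNear Y x) (hZ : SmoothNear Z x) :
    curvature g X Y Z x + curvature g Y Z X x + curvature g Z X Y x = 0 := by
  have e : ∀ {X Y Z : Π y : M, TangentSpace I y}, SmoothNear X x → SmoothNear Y x →
      SmoothNear Z x → covDeriv g X (VectorField.mlieBracket I Y Z) x =
        covDeriv g X (covDeriv g Y Z) x - covDeriv g X (covDeriv g Z Y) x := by
    intro X Y Z hX hY hZ
    rw [← covDeriv_sub_right (hY.covDeriv hZ) (hZ.covDeriv hY)]
    refine covDeriv_congr rfl (hY.mlieBracket hZ) ?_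
    filter_upwards [hY.eventually, hZ.eventually] with y h h'
    exact (mlieBracket_eq g h h').symm
  -- Torsion-freeness, used twice, turns `[X, [Y, Z]]` into `∇_X ∇_Y Z - ∇_X ∇_Z Y - ∇_[Y,Z] X`. The
  -- Jacobi identity then becomes the cyclic sum of curvatures.
  have h1 := mlieBracket_eq g hX (hY.mlieBracket hZ)
  have h2 := mlieBracket_eq g hY (hZ.mlieBracket hX)
  have h3 := mlieBracket_eq g hZ (hX.mlieBracket hY)
  rw [e hX hY hZ] at h1
  rw [e hY hZ hX] at h2
  rw [e hZ hX hY] at h3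
  have hJ := mlieBracket_mlieBracket hX hY hZ
  rw [VectorField.mlieBracket_swap_apply (V := VectorField.mlieBracket I X Y),
    VectorField.mlieBracket_swap (V := X) (W := Z),
    show -VectorField.mlieBracket I Z X = (fun _ : M => (-1 : ℝ)) • VectorField.mlieBracket I Z X
      by ext1; simp,
    VectorField.mlieBracket_smul_right mdifferentiableAt_const
      (hZ.mlieBracket hX).mdifferentiableAt, mvfderiv_const, h1, h2, h3] at hJ
  simp only [curvature]
  rw [← sub_eq_zero] at hJ
  rw [← hJ]
  simp
  module

/-- The curvature operators are skew-symmetric. -/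
lemma inner_curvature (hX : SmoothNear X x) (hY : SmoothNear Y x) (hZ : SmoothNear Z x)
    (hW : SmoothNear W x) :
    g.inner x (curvature g X Y Z x) (W x) + g.inner x (Z x) (curvature g X Y W x) = 0 := by
  have e : ∀ {X Y : Π y : M, TangentSpace I y}, SmoothNear X x → SmoothNear Y x →
      d% (fun y => d% (fun z => g.inner z (Z z) (W z)) y (Y y)) x (X x) =
      (g.inner x (covDeriv g X (covDeriv g Y Z) x) (W x) +
        g.inner x (covDeriv g Y Z x) (covDeriv g X W x)) +
      (g.inner x (covDeriv g X Z x) (covDeriv g Y W x) +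
        g.inner x (Z x) (covDeriv g X (covDeriv g Y W) x)) := by
    intro X Y hX hY
    rw [← mvfderiv_inner hX (hY.covDeriv hZ) hW, ← mvfderiv_inner hX hZ (hY.covDeriv hW),
      ← add_apply, ← mvfderiv_fun_add ((hY.covDeriv hZ).inner g hW).mdifferentiableAt
        (hZ.inner g (hY.covDeriv hW)).mdifferentiableAt]
    congr 1
    refine mvfderiv_congr ?_
    filter_upwards [hY.eventually, hZ.eventually, hW.eventually] with y h1 h2 h3
    exact mvfderiv_inner h1 h2 h3
  -- The claim is `XY - YX - [X, Y] = 0` applied to the function `g(Z, W)`; the mixed first-order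
  -- terms are symmetric in `X`, `Y` and drop out.
  have h := mvfderiv_mlieBracket (hZ.inner g hW) hX hY
  rw [mvfderiv_inner (hX.mlieBracket hY) hZ hW, e hX hY, e hY hX] at h
  simp only [curvature, map_sub, sub_apply]
  linarith

/-! ### The Ricci tensor -/

lemma smoothNear_tangentFrame (i : Fin (Module.finrank ℝ E)) :
    SmoothNear (tangentFrame x i : Π y : M, TangentSpace I y) x :=
  smoothNear_extend _

/-- Removes the basis from the definition: both sides are bilinear, and the curvature is tensorial.
-/
lemma ricciForm_apply (u v : TangentSpace I x) :
    ricciForm g x u v =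
      LinearMap.trace ℝ (TangentSpace I x) (((curvatureAt g x).flip u).flip v) := by
  let B : TangentSpace I x →ₗ[ℝ] TangentSpace I x →ₗ[ℝ] ℝ :=
    LinearMap.mk₂ ℝ (fun u v =>
      LinearMap.trace ℝ (TangentSpace I x) (((curvatureAt g x).flip u).flip v))
      (fun u u' v => by rw [← map_add]; congr 1; ext; simp)
      (fun c u v => by rw [← map_smul]; congr 1; ext; simp)
      (fun u v v' => by rw [← map_add]; congr 1; ext; simp)
      (fun c u v => by rw [← map_smul]; congr 1; ext; simp)
  suffices h : ricciForm g x = B from congr($h u v)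
  refine (tangentBasis x).ext fun i => (tangentBasis x).ext fun j => ?_
  simp only [ricciForm, Module.Basis.constr_basis, B, LinearMap.mk₂_apply]
  congr 1
  refine (tangentBasis x).ext fun k => ?_
  rw [Module.Basis.constr_basis, ← curvatureAt_apply (smoothNear_tangentFrame k)
    (smoothNear_tangentFrame i) (smoothNear_tangentFrame j)]
  simp

/-- Lowering an index conjugates `A` to minus its transpose, so its trace equals its own negative.
-/
lemma trace_eq_zero_of_skew {A : TangentSpace I x →ₗ[ℝ] TangentSpace I x}
    (hA : ∀ u v, g.inner x (A u) v + g.inner x u (A v) = 0) :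
    LinearMap.trace ℝ (TangentSpace I x) A = 0 := by
  have h : (flat g x).conj A = -Module.Dual.transpose A := by
    refine LinearMap.ext fun φ => LinearMap.ext fun v => ?_
    obtain ⟨u, rfl⟩ := (flat g x).surjective φ
    have := hA u v
    simp only [LinearEquiv.conj_apply_apply, LinearEquiv.symm_apply_apply, flat_apply,
      LinearMap.neg_apply, Module.Dual.transpose_apply]
    change _ = -(g.inner x u (A v))
    linarith
  have h1 := LinearMap.trace_conj' A (flat g x)
  have h2 := LinearMap.map_neg (LinearMap.trace ℝ _) (Module.Dual.transpose (R := ℝ) A)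
  rw [LinearMap.trace_transpose'] at h2
  rw [h] at h1
  linarith [h1.symm.trans h2]

/-- The Ricci tensor is symmetric. -/
lemma ricciForm_symm (u v : TangentSpace I x) : ricciForm g x u v = ricciForm g x v u := by
  rw [ricciForm_apply, ricciForm_apply, ← sub_eq_zero, ← map_sub]
  have hu := smoothNear_extend u
  have hv := smoothNear_extend v
  -- By the first Bianchi identity `R(w, u)v - R(w, v)u = R(v, u)w`, and the operator `R(v, u)` is
  -- skew, hence traceless.
  have h : ((curvatureAt g x).flip u).flip v - ((curvatureAt g x).flip v).flip u =
      curvatureAt g x v u := by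
    ext w
    have hw := smoothNear_extend w
    have h1 := curvature_cyclic (g := g) hw hu hv
    rw [curvature_swap (FiberBundle.extend E u),
      curvature_swap (FiberBundle.extend E v) (FiberBundle.extend E w),
      ← curvatureAt_apply hw hu hv, ← curvatureAt_apply hv hu hw,
      ← curvatureAt_apply hw hv hu] at h1
    simp only [FiberBundle.extend_apply_self] at h1
    simp only [LinearMap.sub_apply, LinearMap.flip_apply]
    rw [← sub_eq_zero, ← h1]
    abel
  rw [h]
  refine trace_eq_zero_of_skew (g := g) fun a b => ?_
  have := inner_curvature (g := g) hv hu (smoothNear_extend a) (smoothNear_extend b)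
  simpa only [← curvatureAt_apply, hu, hv, smoothNear_extend, FiberBundle.extend_apply_self]
    using this

lemma inner_ricciEndo (u v : TangentSpace I x) :
    g.inner x (ricciEndo g x u) v = ricciForm g x u v := by
  rw [← flat_apply, ricciEndo, LinearMap.comp_apply, LinearEquiv.coe_coe,
    LinearEquiv.apply_symm_apply]

lemma inner_ricciEndo_right (u v : TangentSpace I x) :
    g.inner x u (ricciEndo g x v) = g.inner x (ricciEndo g x u) v := by
  rw [g.symm, inner_ricciEndo, inner_ricciEndo, ricciForm_symm]

/-! ### Traces of smooth fields of endomorphisms -/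

/-- The field of endomorphisms `A` maps vector fields smooth near `x` to such fields. -/
def SmoothEndoNear (A : Π y : M, TangentSpace I y →ₗ[ℝ] TangentSpace I y) (x : M) : Prop :=
  ∀ X : Π y : M, TangentSpace I y, SmoothNear X x → SmoothNear (fun y => A y (X y)) x

lemma eventually_trace_eq (A : Π y : M, TangentSpace I y →ₗ[ℝ] TangentSpace I y) (x : M) :
    ∀ᶠ y in 𝓝 x, LinearMap.trace ℝ (TangentSpace I y) (A y) =
      ∑ i, localCoframeAt x i y (A y (localFrameAt x i y)) := by
  filter_upwards [eventually_exists_basis (I := I) x] with y ⟨b, hb⟩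
  rw [LinearMap.trace_eq_matrix_trace ℝ b, Matrix.trace]
  refine Finset.sum_congr rfl fun i _ => ?_
  rw [← (hb i).1, ← (hb i).2]
  simp [LinearMap.toMatrix_apply]

lemma SmoothEndoNear.trace {A : Π y : M, TangentSpace I y →ₗ[ℝ] TangentSpace I y}
    (hA : SmoothEndoNear A x) :
    SmoothFunNear I (fun y => LinearMap.trace ℝ (TangentSpace I y) (A y)) x := by
  refine SmoothFunNear.congr ?_ (eventually_trace_eq A x)
  have := eventually_all.mpr fun i =>
    smoothNear_iff_localCoframeAt.mp (hA _ (smoothNear_localFrameAt x i)) i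
  filter_upwards [this] with y hy
  exact ContMDiffAt.sum fun i _ => hy i

lemma smoothEndoNear_curvatureAt (hX : SmoothNear X x) (hY : SmoothNear Y x) :
    SmoothEndoNear (fun y => ((curvatureAt g y).flip (X y)).flip (Y y)) x := by
  intro W hW
  have h : (fun y => ((curvatureAt g y).flip (X y)).flip (Y y) (W y)) =ᶠ[𝓝 x]
      curvature g W X Y := by
    filter_upwards [hX.eventually, hY.eventually, hW.eventually] with y h1 h2 h3
    rw [LinearMap.flip_apply, LinearMap.flip_apply, curvatureAt_apply h3 h1 h2]
  exact (hW.curvature hX hY).congr h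

lemma SmoothNear.ricciForm (hX : SmoothNear X x) (hY : SmoothNear Y x) :
    SmoothFunNear I (fun y => ricciForm g y (X y) (Y y)) x := by
  refine (smoothEndoNear_curvatureAt (g := g) hX hY).trace.congr (Eventually.of_forall fun y => ?_)
  exact ricciForm_apply _ _

lemma smoothEndoNear_ricciEndo (g : Metric I M) (x : M) : SmoothEndoNear (ricciEndo g) x :=
  fun X hX => SmoothNear.of_inner g fun Z hZ => by
    simpa only [inner_ricciEndo] using hX.ricciForm hZ

lemma smoothFunNear_scalarCurvature (g : Metric I M) (x : M) :
    SmoothFunNear I (scalarCurvature g) x :=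
  (smoothEndoNear_ricciEndo g x).trace

end Connection

/-! ### Killing fields preserve the connection, the curvature and the Ricci tensor. -/

section Killing

variable {E : Type*} [NormedAddCommGroup E] [NormedSpace ℝ E] [FiniteDimensional ℝ E]
  {H : Type*} [TopologicalSpace H] {I : ModelWithCorners ℝ E H}
  {M : Type*} [TopologicalSpace M] [ChartedSpace H M] [IsManifold I ∞ M]
  {g : Metric I M} {ξ X Y Z : Π y : M, TangentSpace I y} {x : M}

/-! ### Global extension of tangent vectors -/

/-- Every tangent vector is the value of a globally smooth vector field. -/
lemma exists_isSmoothField_eq [T2Space M] (v : TangentSpace I x) :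
    ∃ Y : Π y : M, TangentSpace I y, IsSmoothField Y ∧ Y x = v := by
  obtain ⟨s, hs, h⟩ := FiberBundle.exists_contMDiffOn_extend (k := ∞) I E v
  obtain ⟨u, hus, hu, hxu⟩ := mem_nhds_iff.mp hs
  obtain ⟨ψ, -, hψ⟩ := (SmoothBumpFunction.nhds_basis_tsupport (I := I) x).mem_iff.mp (hu.mem_nhds hxu)
  refine ⟨(ψ : M → ℝ) • (FiberBundle.extend E v : Π y : M, TangentSpace I y),
    ContMDiffOn.smul_section_of_tsupport ψ.contMDiff.contMDiffOn hu hψ (h.mono hus), ?_⟩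
  simp

/-! ### Sums of vector fields and the Lie bracket -/

lemma mlieBracket_sub_right (hX : SmoothNear X x) (hY : SmoothNear Y x) :
    VectorField.mlieBracket I ξ (X - Y) x =
      VectorField.mlieBracket I ξ X x - VectorField.mlieBracket I ξ Y x := by
  rw [eq_sub_iff_add_eq, ← VectorField.mlieBracket_add_right (hX.sub hY).mdifferentiableAt
    hY.mdifferentiableAt, sub_add_cancel]

lemma mlieBracket_sum_right {ι : Type*} (s : Finset ι) {X : ι → Π y : M, TangentSpace I y}
    (hX : ∀ i ∈ s, SmoothNear (X i) x) :
    VectorField.mlieBracket I ξ (fun y => ∑ i ∈ s, X i y) x =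
      ∑ i ∈ s, VectorField.mlieBracket I ξ (X i) x := by
  classical
  induction s using Finset.induction_on with
  | empty => exact congrFun VectorField.mlieBracket_zero_right x
  | insert i s hi ih =>
    have hs : ∀ j ∈ s, SmoothNear (X j) x := fun j hj => hX j (Finset.mem_insert_of_mem hj)
    rw [Finset.sum_insert hi, ← ih hs, ← VectorField.mlieBracket_add_right
      (hX i (Finset.mem_insert_self i s)).mdifferentiableAt (SmoothNear.sum hs).mdifferentiableAt]
    congr 1
    ext1 y
    simp [Finset.sum_insert hi]

/-- The Lie derivative of the trace of a field of endomorphisms is the trace of its Lie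
derivative. -/
lemma mvfderiv_trace {A : Π y : M, TangentSpace I y →ₗ[ℝ] TangentSpace I y}
    (hA : SmoothEndoNear A x) {B : TangentSpace I x →ₗ[ℝ] TangentSpace I x}
    (hB : ∀ W : Π y : M, TangentSpace I y, SmoothNear W x →
      VectorField.mlieBracket I ξ (fun y => A y (W y)) x
        - A x (VectorField.mlieBracket I ξ W x) = B (W x)) :
    d% (fun y => LinearMap.trace ℝ (TangentSpace I y) (A y)) x (ξ x) =
      LinearMap.trace ℝ (TangentSpace I x) B := by
  let F : Fin (Module.finrank ℝ E) → Π y : M, TangentSpace I y := localFrameAt x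
  have hF : ∀ k, SmoothNear (F k) x := smoothNear_localFrameAt x
  let a : Fin (Module.finrank ℝ E) → Fin (Module.finrank ℝ E) → M → ℝ := fun j k y =>
    localCoframeAt x j y (A y (F k y))
  have ha : ∀ j k, SmoothFunNear I (a j k) x := fun j k =>
    smoothNear_iff_localCoframeAt.mp (hA _ (hF k)) j
  obtain ⟨b, hb⟩ := (eventually_exists_basis (I := I) x).self_of_nhds
  -- With `a` the matrix of `A` in the frame and `c` that of `[ξ, ·]` on the frame fields at `x`,
  -- the matrix of `B` is `ξ(a) + ca - ac`. The commutator does not contribute to the trace.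
  let c : Fin (Module.finrank ℝ E) → Fin (Module.finrank ℝ E) → ℝ := fun j k =>
    b.coord j (VectorField.mlieBracket I ξ (F k) x)
  have hbF : ∀ k, b k = F k x := fun k => (hb k).1
  have h1 : ∀ k, b.coord k (B (b k)) =
      d% (a k k) x (ξ x) + ∑ j, (a j k x * c k j - c j k * a k j x) := by
    intro k
    have e1 : VectorField.mlieBracket I ξ (fun y => A y (F k y)) x =
        ∑ j, (d% (a j k) x (ξ x) • b j + a j k x • VectorField.mlieBracket I ξ (F j) x) := by
      have := EventuallyEq.mlieBracket_vectorField_eq (EventuallyEq.refl _ ξ)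
        (eventually_eq_sum_localFrameAt (fun y => A y (F k y)) x)
      refine this.trans ((mlieBracket_sum_right (X := fun j => a j k • F j) _
        fun j _ => SmoothNear.smul (ha j k) (hF j)).trans ?_)
      refine Finset.sum_congr rfl fun j _ => ?_
      rw [VectorField.mlieBracket_smul_right (ha j k).mdifferentiableAt (hF j).mdifferentiableAt,
        hbF]
    have e2 : A x (VectorField.mlieBracket I ξ (F k) x) = ∑ j, c j k • A x (F j x) := by
      conv_lhs => rw [← b.sum_repr (VectorField.mlieBracket I ξ (F k) x)]
      rw [map_sum]
      refine Finset.sum_congr rfl fun j _ => ?_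
      rw [map_smul, hbF]
      rfl
    rw [hbF, ← hB _ (hF k), e1, e2, map_sub, map_sum, map_sum, Finset.sum_sub_distrib]
    have e3 : ∀ j, b.coord k (A x (F j x)) = a k j x := fun j => by rw [(hb k).2]
    simp only [map_add, map_smul, e3, smul_eq_mul, Finset.sum_add_distrib]
    have e4 : ∑ j, d% (a j k) x (ξ x) * b.coord k (b j) = d% (a k k) x (ξ x) := by
      rw [Finset.sum_eq_single k]
      · simp
      · intro j _ hj
        simp [hj]
      · simp
    rw [e4]
    ring
  have h2 : LinearMap.trace ℝ (TangentSpace I x) B = ∑ k, b.coord k (B (b k)) := by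
    rw [LinearMap.trace_eq_matrix_trace ℝ b, Matrix.trace]
    exact Finset.sum_congr rfl fun k _ => by simp [LinearMap.toMatrix_apply]
  have h3 : d% (fun y => LinearMap.trace ℝ (TangentSpace I y) (A y)) x (ξ x) =
      ∑ k, d% (a k k) x (ξ x) := by
    rw [mvfderiv_congr (eventually_trace_eq A x)]
    have : ∀ s : Finset (Fin (Module.finrank ℝ E)),
        SmoothFunNear I (fun y => ∑ k ∈ s, a k k y) x ∧
        d% (fun y => ∑ k ∈ s, a k k y) x (ξ x) = ∑ k ∈ s, d% (a k k) x (ξ x) := by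
      intro s
      induction s using Finset.induction_on with
      | empty =>
        refine ⟨Eventually.of_forall fun _ => contMDiffAt_const, ?_⟩
        simp [mvfderiv_const]
      | insert k s hk ih =>
        simp only [Finset.sum_insert hk]
        refine ⟨?_, ?_⟩
        · filter_upwards [ha k k, ih.1] with y h1 h2
          exact h1.add h2
        · rw [mvfderiv_fun_add (ha k k).mdifferentiableAt ih.1.mdifferentiableAt, add_apply, ih.2]
    exact (this Finset.univ).2
  rw [h2, h3, Finset.sum_congr rfl fun k _ => h1 k, Finset.sum_add_distrib]
  simp only [Finset.sum_sub_distrib]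
  rw [Finset.sum_comm (f := fun k j => a j k x * c k j)]
  simp [mul_comm]

/-! ### Killing fields preserve the curvature -/

/-- As the connection is metric and torsion-free, `(L_ξ g)(X, Y) = g(∇_X ξ, Y) + g(X, ∇_Y ξ)`. This
is pointwise in `X` and `Y`, and every tangent vector extends to a global smooth field. -/
lemma isKillingField_iff [T2Space M] (hξ : IsSmoothField ξ) :
    IsKillingField g ξ ↔ ∀ (x : M) (u v : TangentSpace I x),
      g.inner x (leviCivita g ξ x u) v + g.inner x u (leviCivita g ξ x v) = 0 := by
  have key : ∀ {X Y : Π y : M, TangentSpace I y}, IsSmoothField X → IsSmoothField Y → ∀ x,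
      d% (fun y => g.inner y (X y) (Y y)) x (ξ x)
        - (g.inner x (VectorField.mlieBracket I ξ X x) (Y x)
          + g.inner x (X x) (VectorField.mlieBracket I ξ Y x)) =
      g.inner x (leviCivita g ξ x (X x)) (Y x) + g.inner x (X x) (leviCivita g ξ x (Y x)) := by
    intro X Y hX hY x
    rw [mvfderiv_inner (hξ.smoothNear x) (hX.smoothNear x) (hY.smoothNear x),
      mlieBracket_eq g (hξ.smoothNear x) (hX.smoothNear x),
      mlieBracket_eq g (hξ.smoothNear x) (hY.smoothNear x)]
    simp only [covDeriv, map_sub, sub_apply]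
    ring
  refine ⟨fun h x u v => ?_, fun h => ⟨hξ, fun X Y hX hY x => ?_⟩⟩
  · obtain ⟨X, hX, rfl⟩ := exists_isSmoothField_eq u
    obtain ⟨Y, hY, rfl⟩ := exists_isSmoothField_eq v
    rw [← key hX hY, sub_eq_zero]
    exact h.2 X Y hX hY x
  · rw [← sub_eq_zero, key hX hY, h]

variable [T2Space M]

lemma IsKillingField.skew (hξ : IsKillingField g ξ) (u v : TangentSpace I x) :
    g.inner x (leviCivita g ξ x u) v + g.inner x u (leviCivita g ξ x v) = 0 :=
  (isKillingField_iff hξ.1).mp hξ x u v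

/-- Frees the Killing equation from global test fields, so that it can be applied to local
extensions. -/
lemma IsKillingField.mvfderiv_inner (hξ : IsKillingField g ξ) (hX : SmoothNear X x)
    (hY : SmoothNear Y x) :
    d% (fun y => g.inner y (X y) (Y y)) x (ξ x) =
      g.inner x (VectorField.mlieBracket I ξ X x) (Y x)
        + g.inner x (X x) (VectorField.mlieBracket I ξ Y x) := by
  have h := hξ.skew (X x) (Y x)
  have h' := hξ.1.smoothNear x
  rw [BiHermitian.mvfderiv_inner h' hX hY, mlieBracket_eq g h' hX, mlieBracket_eq g h' hY]
  simp only [covDeriv, map_sub, sub_apply] at h ⊢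
  linarith

/-- Killing fields preserve the Levi-Civita connection. -/
lemma IsKillingField.mlieBracket_covDeriv (hξ : IsKillingField g ξ) (hX : SmoothNear X x)
    (hY : SmoothNear Y x) :
    VectorField.mlieBracket I ξ (covDeriv g X Y) x =
      covDeriv g (VectorField.mlieBracket I ξ X) Y x
        + covDeriv g X (VectorField.mlieBracket I ξ Y) x := by
  have hξ' := hξ.1.smoothNear x
  -- `A X Y` is `(L_ξ ∇)_X Y`. It is symmetric, by the Jacobi identity and torsion-freeness, and
  -- `g(A X Y, Z)` is skew in `Y`, `Z`, by invariance of the metric.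
  let A : (Π y : M, TangentSpace I y) → (Π y : M, TangentSpace I y) → TangentSpace I x :=
    fun X Y => VectorField.mlieBracket I ξ (covDeriv g X Y) x -
      (covDeriv g (VectorField.mlieBracket I ξ X) Y x
        + covDeriv g X (VectorField.mlieBracket I ξ Y) x)
  have hsymm : ∀ {X Y}, SmoothNear X x → SmoothNear Y x → A X Y = A Y X := by
    intro X Y hX hY
    have h1 : VectorField.mlieBracket I ξ (VectorField.mlieBracket I X Y) x =
        VectorField.mlieBracket I ξ (covDeriv g X Y) x
          - VectorField.mlieBracket I ξ (covDeriv g Y X) x := by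
      rw [← mlieBracket_sub_right (hX.covDeriv hY) (hY.covDeriv hX)]
      refine EventuallyEq.mlieBracket_vectorField_eq (EventuallyEq.refl _ ξ) ?_
      filter_upwards [hX.eventually, hY.eventually] with y h h'
      exact mlieBracket_eq g h h'
    rw [mlieBracket_mlieBracket hξ' hX hY, mlieBracket_eq g (hξ'.mlieBracket hX) hY,
      mlieBracket_eq g hX (hξ'.mlieBracket hY)] at h1
    simp only [A]
    rw [← sub_eq_zero] at h1 ⊢
    rw [← neg_eq_zero, ← h1]
    abel
  have hskew : ∀ {X Y Z}, SmoothNear X x → SmoothNear Y x → SmoothNear Z x →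
      g.inner x (A X Y) (Z x) = -g.inner x (A X Z) (Y x) := by
    intro X Y Z hX hY hZ
    -- The function `[ξ, X] g(Y, Z)` is computed directly and as a commutator of derivatives.
    have h := mvfderiv_mlieBracket (hY.inner g hZ) hξ' hX
    have e1 : d% (fun y => d% (fun z => g.inner z (Y z) (Z z)) y (X y)) x (ξ x) =
        (g.inner x (VectorField.mlieBracket I ξ (covDeriv g X Y) x) (Z x) +
          g.inner x (covDeriv g X Y x) (VectorField.mlieBracket I ξ Z x)) +
        (g.inner x (VectorField.mlieBracket I ξ Y x) (covDeriv g X Z x) +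
          g.inner x (Y x) (VectorField.mlieBracket I ξ (covDeriv g X Z) x)) := by
      rw [← hξ.mvfderiv_inner (hX.covDeriv hY) hZ, ← hξ.mvfderiv_inner hY (hX.covDeriv hZ),
        ← add_apply, ← mvfderiv_fun_add ((hX.covDeriv hY).inner g hZ).mdifferentiableAt
          (hY.inner g (hX.covDeriv hZ)).mdifferentiableAt]
      congr 1
      refine mvfderiv_congr ?_
      filter_upwards [hX.eventually, hY.eventually, hZ.eventually] with y h1 h2 h3
      exact BiHermitian.mvfderiv_inner h1 h2 h3
    have e2 : d% (fun y => d% (fun z => g.inner z (Y z) (Z z)) y (ξ y)) x (X x) =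
        (g.inner x (covDeriv g X (VectorField.mlieBracket I ξ Y) x) (Z x) +
          g.inner x (VectorField.mlieBracket I ξ Y x) (covDeriv g X Z x)) +
        (g.inner x (covDeriv g X Y x) (VectorField.mlieBracket I ξ Z x) +
          g.inner x (Y x) (covDeriv g X (VectorField.mlieBracket I ξ Z) x)) := by
      rw [← BiHermitian.mvfderiv_inner hX (hξ'.mlieBracket hY) hZ,
        ← BiHermitian.mvfderiv_inner hX hY (hξ'.mlieBracket hZ),
        ← add_apply, ← mvfderiv_fun_add ((hξ'.mlieBracket hY).inner g hZ).mdifferentiableAt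
          (hY.inner g (hξ'.mlieBracket hZ)).mdifferentiableAt]
      congr 1
      refine mvfderiv_congr ?_
      filter_upwards [hY.eventually, hZ.eventually] with y h2 h3
      exact hξ.mvfderiv_inner h2 h3
    rw [e1, e2, BiHermitian.mvfderiv_inner (hξ'.mlieBracket hX) hY hZ] at h
    rw [g.symm x (A X Z)]
    simp only [A, map_sub, map_add, sub_apply, add_apply]
    linarith
  rw [← sub_eq_zero]
  refine ext_inner (g := g) fun u => ?_
  have hZ := smoothNear_extend u
  rw [← FiberBundle.extend_apply_self (F := E) u]
  generalize (FiberBundle.extend E u : Π y : M, TangentSpace I y) = Z at hZ ⊢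
  change g.inner x (A X Y) (Z x) = _
  -- A trilinear expression symmetric in its first two slots and skew in its last two vanishes:
  -- three swaps of each kind return it to itself with the opposite sign.
  have h1 := hskew hX hY hZ
  rw [hsymm hX hZ, hskew hZ hX hY, hsymm hZ hY, hskew hY hZ hX, hsymm hY hX] at h1
  simp only [map_zero, zero_apply]
  linarith

/-- Killing fields preserve the curvature. -/
lemma IsKillingField.mlieBracket_curvature (hξ : IsKillingField g ξ) (hX : SmoothNear X x)
    (hY : SmoothNear Y x) (hZ : SmoothNear Z x) :
    VectorField.mlieBracket I ξ (curvature g X Y Z) x =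
      curvature g (VectorField.mlieBracket I ξ X) Y Z x
        + curvature g X (VectorField.mlieBracket I ξ Y) Z x
        + curvature g X Y (VectorField.mlieBracket I ξ Z) x := by
  have hξ' := hξ.1.smoothNear x
  have e : ∀ {X Y}, SmoothNear X x → SmoothNear Y x →
      VectorField.mlieBracket I ξ (covDeriv g X (covDeriv g Y Z)) x =
        covDeriv g (VectorField.mlieBracket I ξ X) (covDeriv g Y Z) x +
          (covDeriv g X (covDeriv g (VectorField.mlieBracket I ξ Y) Z) x +
            covDeriv g X (covDeriv g Y (VectorField.mlieBracket I ξ Z)) x) := by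
    intro X Y hX hY
    have hev : covDeriv g (VectorField.mlieBracket I ξ Y) Z
        + covDeriv g Y (VectorField.mlieBracket I ξ Z) =ᶠ[𝓝 x]
          VectorField.mlieBracket I ξ (covDeriv g Y Z) := by
      filter_upwards [hY.eventually, hZ.eventually] with y h1 h2
      exact (hξ.mlieBracket_covDeriv h1 h2).symm
    have h := covDeriv_congr (g := g) (X := X) (X' := X) rfl
      (hξ'.mlieBracket (hY.covDeriv hZ)) hev
    rw [hξ.mlieBracket_covDeriv hX (hY.covDeriv hZ), h, covDeriv_add_right
      ((hξ'.mlieBracket hY).covDeriv hZ) (hY.covDeriv (hξ'.mlieBracket hZ))]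
  have e' : covDeriv g (VectorField.mlieBracket I ξ (VectorField.mlieBracket I X Y)) Z x =
      covDeriv g (VectorField.mlieBracket I (VectorField.mlieBracket I ξ X) Y) Z x +
        covDeriv g (VectorField.mlieBracket I X (VectorField.mlieBracket I ξ Y)) Z x := by
    simp only [covDeriv]
    rw [mlieBracket_mlieBracket hξ' hX hY, map_add]
  have h : VectorField.mlieBracket I ξ (curvature g X Y Z) x =
      VectorField.mlieBracket I ξ (covDeriv g X (covDeriv g Y Z)) x -
        VectorField.mlieBracket I ξ (covDeriv g Y (covDeriv g X Z)) x -
        VectorField.mlieBracket I ξ (covDeriv g (VectorField.mlieBracket I X Y) Z) x := by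
    rw [← mlieBracket_sub_right (hX.covDeriv (hY.covDeriv hZ)) (hY.covDeriv (hX.covDeriv hZ)),
      ← mlieBracket_sub_right ((hX.covDeriv (hY.covDeriv hZ)).sub (hY.covDeriv (hX.covDeriv hZ)))
        ((hX.mlieBracket hY).covDeriv hZ)]
    rfl
  rw [h, e hX hY, e hY hX, hξ.mlieBracket_covDeriv (hX.mlieBracket hY) hZ, e']
  simp only [curvature]
  abel

/-- Killing fields preserve the Ricci tensor. -/
lemma IsKillingField.mvfderiv_ricciForm (hξ : IsKillingField g ξ) (hX : SmoothNear X x)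
    (hY : SmoothNear Y x) :
    d% (fun y => ricciForm g y (X y) (Y y)) x (ξ x) =
      ricciForm g x (VectorField.mlieBracket I ξ X x) (Y x)
        + ricciForm g x (X x) (VectorField.mlieBracket I ξ Y x) := by
  have hξ' := hξ.1.smoothNear x
  simp only [ricciForm_apply]
  rw [← map_add]
  refine mvfderiv_trace (smoothEndoNear_curvatureAt hX hY) fun W hW => ?_
  have h : (fun y => ((curvatureAt g y).flip (X y)).flip (Y y) (W y)) =ᶠ[𝓝 x]
      curvature g W X Y := by
    filter_upwards [hX.eventually, hY.eventually, hW.eventually] with y h1 h2 h3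
    rw [LinearMap.flip_apply, LinearMap.flip_apply, curvatureAt_apply h3 h1 h2]
  rw [EventuallyEq.mlieBracket_vectorField_eq (EventuallyEq.refl _ ξ) h,
    hξ.mlieBracket_curvature hW hX hY]
  simp only [LinearMap.flip_apply, LinearMap.add_apply]
  rw [curvatureAt_apply (hξ'.mlieBracket hW) hX hY, curvatureAt_apply hW (hξ'.mlieBracket hX) hY,
    curvatureAt_apply hW hX (hξ'.mlieBracket hY)]
  abel

/-- `Ric` is `ρ` with an index raised by `g`, and `ξ` preserves both `ρ` and `g`. -/
lemma IsKillingField.mlieBracket_ricciEndo (hξ : IsKillingField g ξ) (hX : SmoothNear X x) :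
    VectorField.mlieBracket I ξ (fun y => ricciEndo g y (X y)) x =
      ricciEndo g x (VectorField.mlieBracket I ξ X x) := by
  refine ext_inner (g := g) fun u => ?_
  have hZ := smoothNear_extend u
  rw [← FiberBundle.extend_apply_self (F := E) u]
  generalize (FiberBundle.extend E u : Π y : M, TangentSpace I y) = Z at hZ ⊢
  have h1 := hξ.mvfderiv_ricciForm hX hZ
  have h2 := hξ.mvfderiv_inner (smoothEndoNear_ricciEndo g x X hX) hZ
  simp only [inner_ricciEndo] at h2 ⊢
  linarith

/-- The scalar curvature is constant along Killing fields. -/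
lemma IsKillingField.mvfderiv_scalarCurvature (hξ : IsKillingField g ξ) (x : M) :
    d% (scalarCurvature g) x (ξ x) = 0 := by
  rw [← map_zero (LinearMap.trace ℝ (TangentSpace I x))]
  refine mvfderiv_trace (smoothEndoNear_ricciEndo g x) fun W hW => ?_
  rw [hξ.mlieBracket_ricciEndo hW, sub_self, LinearMap.zero_apply]

/-- Along a Killing field, the covariant derivative of the Ricci endomorphism is its commutator
with the derivative of the Killing field. -/
lemma IsKillingField.covDeriv_ricciEndo (hξ : IsKillingField g ξ) (hX : SmoothNear X x) :
    covDeriv g ξ (fun y => ricciEndo g y (X y)) x - ricciEndo g x (covDeriv g ξ X x) =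
      leviCivita g ξ x (ricciEndo g x (X x)) - ricciEndo g x (leviCivita g ξ x (X x)) := by
  have hξ' := hξ.1.smoothNear x
  have h := hξ.mlieBracket_ricciEndo hX
  rw [mlieBracket_eq g hξ' (smoothEndoNear_ricciEndo g x X hX), mlieBracket_eq g hξ' hX,
    map_sub] at h
  change _ - leviCivita g ξ x (ricciEndo g x (X x)) = _ - ricciEndo g x (leviCivita g ξ x (X x))
    at h
  rw [sub_eq_sub_iff_add_eq_add] at h ⊢
  rw [add_comm, ← sub_eq_zero] at h
  rw [← sub_eq_zero, ← neg_eq_zero, ← neg_eq_zero, ← h]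
  abel

end Killing

/-! ### Linear algebra of two complex structures on a four-dimensional Euclidean space. -/

section Algebra

open Module

/-! ### Symmetric endomorphisms commuting with two complex structures -/

variable {V : Type*} [NormedAddCommGroup V] [InnerProductSpace ℝ V]

lemma inner_complexStructure_self {J : V →ₗ[ℝ] V} (hJ : ∀ v, J (J v) = -v)
    (hJo : ∀ v w, inner ℝ (J v) (J w) = inner ℝ v w) (v : V) : inner ℝ v (J v) = 0 := by
  have h := hJo v (J v)
  rw [hJ, inner_neg_right, real_inner_comm] at h
  linarith

/-- A complex structure on a four-dimensional space does not induce the opposite orientation of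
that induced by `J` or by `-J`. -/
lemma not_induceOppositeOrientations {J J' : V →ₗ[ℝ] V}
    (b : Basis (Fin 4) ℝ V) (h1 : b 1 = J (b 0)) (h3 : b 3 = J (b 2))
    (h : J' = J ∨ J' = -J) : ¬ InduceOppositeOrientations J J' := by
  rintro ⟨o, ho, ho'⟩
  have e := ho b h1 h3
  rcases h with rfl | rfl
  · have e' := ho' b h1 h3
    rw [e] at e'
    exact Module.Ray.ne_neg_self o e'
  -- If `J' = -J`, negating the second and fourth vectors adapts the basis to `J'`; two sign changes
  -- keep the orientation.
  · let w : Fin 4 → ℝˣ := ![1, -1, 1, -1]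
    have e' := ho' (b.unitsSMul w) (by simp [w, Basis.unitsSMul_apply, h1, Units.smul_def])
      (by simp [w, Basis.unitsSMul_apply, h3, Units.smul_def])
    rw [Basis.orientation_unitsSMul, e] at e'
    have : ∏ i, w i = 1 := by simp [w, Fin.prod_univ_four]
    rw [this] at e'
    simp at e'
    exact Module.Ray.ne_neg_self o e'

lemma exists_eigenvector_mem [FiniteDimensional ℝ V] {S : V →ₗ[ℝ] V} (hS : S.IsSymmetric)
    {W : Submodule ℝ V} (hW : ∀ v ∈ W, S v ∈ W) (hW0 : 0 < finrank ℝ W) :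
    ∃ v ∈ W, v ≠ 0 ∧ ∃ a : ℝ, S v = a • v := by
  have h := hS.restrict_invariant hW
  obtain ⟨v, hv⟩ := (h.hasEigenvalue_eigenvalues rfl ⟨0, hW0⟩).exists_hasEigenvector
  refine ⟨v, v.2, fun h0 => hv.2 (Subtype.ext h0), h.eigenvalues rfl ⟨0, hW0⟩, ?_⟩
  simpa using congrArg Subtype.val hv.apply_eq_smul

/-- A symmetric endomorphism `S` commuting with the orthogonal complex structure `J` of a
four-dimensional space is diagonal in a basis of the form `(u, J u, v, J v)`. -/
lemma exists_basis_complexStructure (hV : finrank ℝ V = 4) {J S : V →ₗ[ℝ] V}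
    (hJ : ∀ v, J (J v) = -v) (hJo : ∀ v w, inner ℝ (J v) (J w) = inner ℝ v w) (hS : S.IsSymmetric)
    (hSJ : ∀ v, S (J v) = J (S v)) :
    ∃ (b : Basis (Fin 4) ℝ V) (p q : ℝ), b 1 = J (b 0) ∧ b 3 = J (b 2) ∧
      S (b 0) = p • b 0 ∧ S (b 2) = q • b 2 := by
  have : FiniteDimensional ℝ V := FiniteDimensional.of_finrank_eq_succ hV
  have hJ0 : ∀ v, inner ℝ v (J v) = 0 := inner_complexStructure_self hJ hJo
  have hJ1 : ∀ v w, inner ℝ (J v) w = -inner ℝ v (J w) := fun v w => by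
    rw [← hJo v, hJ, inner_neg_right, neg_neg]
  obtain ⟨u, -, hu, p, hp⟩ := exists_eigenvector_mem hS (W := ⊤) (fun _ _ => trivial) (by
    rw [finrank_top, hV]; norm_num)
  have hpJ : S (J u) = p • J u := by rw [hSJ, hp, map_smul]
  -- The span of `u`, `J u` is `S`-invariant, so by symmetry its complement is too and contains a
  -- second eigenvector.
  let W := (Submodule.span ℝ {u, J u})ᗮ
  have hmem : ∀ v, v ∈ W ↔ inner ℝ u v = 0 ∧ inner ℝ (J u) v = 0 := by
    intro v
    refine ⟨fun h => ⟨h u (Submodule.subset_span (by simp)),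
      h (J u) (Submodule.subset_span (by simp))⟩, fun h w hw => ?_⟩
    obtain ⟨s, t, rfl⟩ := Submodule.mem_span_pair.mp hw
    simp [inner_add_left, inner_smul_left, h.1, h.2]
  have hWS : ∀ v ∈ W, S v ∈ W := by
    intro v hv
    rw [hmem] at hv ⊢
    rw [← hS, ← hS, hp, hpJ, inner_smul_left, inner_smul_left, hv.1, hv.2]
    simp
  have hW0 : 0 < finrank ℝ W := by
    classical
    have h1 := (Submodule.span ℝ {u, J u}).finrank_add_finrank_orthogonal
    have h2 := finrank_span_finset_le_card (R := ℝ) ({u, J u} : Finset V)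
    have h3 := Finset.card_le_two (a := u) (b := J u)
    rw [Set.finrank, Finset.coe_pair] at h2
    change 0 < finrank ℝ (Submodule.span ℝ {u, J u})ᗮ
    omega
  obtain ⟨v, hvW, hv, q, hq⟩ := exists_eigenvector_mem hS hWS hW0
  obtain ⟨huv, hJuv⟩ := (hmem v).mp hvW
  have hne : ∀ {w}, w ≠ 0 → J w ≠ 0 := fun hw h0 => hw (by
    rw [← neg_eq_zero, ← hJ, h0, map_zero])
  have hli : LinearIndependent ℝ ![u, J u, v, J v] := by
    refine linearIndependent_of_ne_zero_of_inner_eq_zero ?_ ?_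
    · intro i
      fin_cases i
      exacts [hu, hne hu, hv, hne hv]
    · have huJv : inner ℝ u (J v) = 0 := by rw [← neg_eq_zero, ← hJ1, hJuv]
      have hs : ∀ i j : Fin 4, i < j → inner ℝ ((![u, J u, v, J v] : Fin 4 → V) i)
          ((![u, J u, v, J v] : Fin 4 → V) j) = 0 := by
        intro i j hij
        fin_cases i <;> fin_cases j <;> first | exact absurd hij (by decide) | skip
        exacts [hJ0 u, huv, huJv, hJuv, (hJo u v).trans huv, hJ0 v]
      intro i j hij
      rcases lt_or_gt_of_ne hij with h | h
      · exact hs i j h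
      · rw [real_inner_comm]
        exact hs j i h
  refine ⟨basisOfLinearIndependentOfCardEqFinrank hli (by simp [hV]), p, q, ?_⟩
  simp [hp, hq]

/-- In dimension four, a commutator `[T, S]` with a symmetric endomorphism `S` vanishes if both
commute with two orthogonal complex structures which induce opposite orientations. -/
lemma commutator_eq_zero (hV : finrank ℝ V = 4) {J J' S T : V →ₗ[ℝ] V}
    (hJ : ∀ v, J (J v) = -v) (hJo : ∀ v w, inner ℝ (J v) (J w) = inner ℝ v w)
    (hJ' : ∀ v, J' (J' v) = -v) (hJo' : ∀ v w, inner ℝ (J' v) (J' w) = inner ℝ v w)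
    (hor : InduceOppositeOrientations J J') (hS : S.IsSymmetric)
    (hSJ : ∀ v, S (J v) = J (S v)) (hSJ' : ∀ v, S (J' v) = J' (S v))
    (hDJ : ∀ v, (T * S - S * T) (J v) = J ((T * S - S * T) v))
    (hDJ' : ∀ v, (T * S - S * T) (J' v) = J' ((T * S - S * T) v)) :
    T * S - S * T = 0 := by
  obtain ⟨b, p, q, h1, h3, hp, hq⟩ := exists_basis_complexStructure hV hJ hJo hS hSJ
  have hp1 : S (b 1) = p • b 1 := by rw [h1, hSJ, hp, map_smul]
  have hq3 : S (b 3) = q • b 3 := by rw [h3, hSJ, hq, map_smul]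
  by_cases hpq : p = q
  · have : S = p • (1 : Module.End ℝ V) := by
      refine b.ext fun i => ?_
      fin_cases i
      exacts [hp, hp1, by simpa [hpq] using hq, by simpa [hpq] using hq3]
    rw [this]
    simp
  have hJ0 : ∀ v, inner ℝ v (J v) = 0 := inner_complexStructure_self hJ hJo
  have hJ0' : ∀ v, inner ℝ v (J' v) = 0 := inner_complexStructure_self hJ' hJo'
  have hsum : ∀ w, w = b.repr w 0 • b 0 + b.repr w 1 • b 1 + b.repr w 2 • b 2
      + b.repr w 3 • b 3 := fun w => by
    conv_lhs => rw [← b.sum_repr w, Fin.sum_univ_four]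
  have hSrepr : ∀ w, b.repr (S w) 0 = p * b.repr w 0 ∧ b.repr (S w) 1 = p * b.repr w 1 ∧
      b.repr (S w) 2 = q * b.repr w 2 ∧ b.repr (S w) 3 = q * b.repr w 3 := by
    intro w
    have : S w = (p * b.repr w 0) • b 0 + (p * b.repr w 1) • b 1 + (q * b.repr w 2) • b 2
        + (q * b.repr w 3) • b 3 := by
      conv_lhs => rw [hsum w]
      simp only [map_add, map_smul, hp, hp1, hq, hq3, smul_smul, mul_comm]
    rw [this]
    simp
  have hsq : ∀ {v : V} {c : ℝ}, v ≠ 0 → J' v = c • J v → c = 1 ∨ c = -1 := by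
    intro v c hv hc
    have h := hJo' v v
    rw [hc, inner_smul_left, inner_smul_right, hJo] at h
    have hv' : inner ℝ v v ≠ 0 := inner_self_ne_zero.mpr hv
    have : c * c = 1 := by
      apply mul_right_cancel₀ hv'
      simpa [mul_assoc] using h
    exact mul_self_eq_one_iff.mp this
  -- `J'` commutes with `S` and `p ≠ q`, so `J' (b 0)` stays in the `p`-eigenplane spanned by `b 0`
  -- and `J (b 0)`. It is orthogonal to `b 0` and has the same length, hence equals `±J (b 0)`.
  have hc : ∃ c : ℝ, (c = 1 ∨ c = -1) ∧ J' (b 0) = c • J (b 0) := by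
    obtain ⟨-, -, e2, e3⟩ := hSrepr (J' (b 0))
    rw [hSJ', hp, map_smul] at e2 e3
    simp only [map_smul, Finsupp.smul_apply, smul_eq_mul] at e2 e3
    have e2' := (mul_eq_mul_right_iff.mp e2).resolve_left hpq
    have e3' := (mul_eq_mul_right_iff.mp e3).resolve_left hpq
    have e := hsum (J' (b 0))
    rw [e2', e3', zero_smul, zero_smul, add_zero, add_zero, h1] at e
    have h := hJ0' (b 0)
    rw [e, inner_add_right, inner_smul_right, inner_smul_right, hJ0, mul_zero, add_zero] at h
    rw [(mul_eq_zero.mp h).resolve_right (inner_self_ne_zero.mpr (b.ne_zero 0)), zero_smul,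
      zero_add] at e
    exact ⟨_, hsq (b.ne_zero 0) e, e⟩
  have hd : ∃ d : ℝ, (d = 1 ∨ d = -1) ∧ J' (b 2) = d • J (b 2) := by
    obtain ⟨e0, e1, -, -⟩ := hSrepr (J' (b 2))
    rw [hSJ', hq, map_smul] at e0 e1
    simp only [map_smul, Finsupp.smul_apply, smul_eq_mul] at e0 e1
    have e0' := (mul_eq_mul_right_iff.mp e0).resolve_left (Ne.symm hpq)
    have e1' := (mul_eq_mul_right_iff.mp e1).resolve_left (Ne.symm hpq)
    have e := hsum (J' (b 2))
    rw [e0', e1', zero_smul, zero_smul, zero_add, zero_add, h3] at e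
    have h := hJ0' (b 2)
    rw [e, inner_add_right, inner_smul_right, inner_smul_right, hJ0, mul_zero, add_zero] at h
    rw [(mul_eq_zero.mp h).resolve_right (inner_self_ne_zero.mpr (b.ne_zero 2)), zero_smul,
      zero_add] at e
    exact ⟨_, hsq (b.ne_zero 2) e, e⟩
  obtain ⟨c, hc1, hc⟩ := hc
  obtain ⟨d, hd1, hd⟩ := hd
  have hflip : ∀ {v : V} {c : ℝ}, (c = 1 ∨ c = -1) → J' v = c • J v → J' (J v) = c • J (J v) := by
    intro v c hc1 hc
    have h := hJ' v
    rcases hc1 with rfl | rfl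
    · rw [one_smul] at hc ⊢
      rw [← hc, h, hc, hJ]
    · rw [neg_smul, one_smul] at hc ⊢
      rw [hc, map_neg, neg_eq_iff_eq_neg, neg_neg] at h
      rw [h, hJ, neg_neg]
  have hc' := hflip hc1 hc
  have hd' := hflip hd1 hd
  -- Equal signs would make `J' = ±J` globally, against the opposite orientations.
  have hcd : d = -c := by
    by_contra hne
    have hdc : d = c := by
      rcases hc1 with h | h <;> rcases hd1 with h' | h'
      · rw [h, h']
      · exact absurd (by rw [h, h']) hne
      · exact absurd (by rw [h, h', neg_neg]) hne
      · rw [h, h']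
    subst hdc
    have hJJ : J' = d • J := by
      refine b.ext fun i => ?_
      fin_cases i
      exacts [hc, by simpa [h1] using hc', hd, by simpa [h3] using hd']
    refine not_induceOppositeOrientations b h1 h3 ?_ hor
    rcases hc1 with rfl | rfl <;> simp [hJJ]
  subst hcd
  have hcc : c * c = 1 := mul_self_eq_one_iff.mpr hc1
  let K : Module.End ℝ V := J * J'
  have hK : ∀ v, K v = J (J' v) := fun v => rfl
  have hK0 : K (b 0) = -c • b 0 := by rw [hK, hc, map_smul, hJ, smul_neg, neg_smul]
  have hK1 : K (b 1) = -c • b 1 := by rw [hK, h1, hc', map_smul, hJ, smul_neg, neg_smul]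
  have hK2 : K (b 2) = c • b 2 := by
    rw [hK, hd, map_smul, hJ, smul_neg, neg_smul, neg_neg]
  have hK3 : K (b 3) = c • b 3 := by
    rw [hK, h3, hd', map_smul, hJ, smul_neg, neg_smul, neg_neg]
  have hKK : K * K = 1 := by
    refine b.ext fun i => ?_
    fin_cases i
    · simp [hK0, smul_smul, hcc]
    · simp [hK1, smul_smul, hcc]
    · simp [hK2, smul_smul, hcc]
    · simp [hK3, smul_smul, hcc]
  -- The coefficients solve `α - cβ = p`, `α + cβ = q` with `c² = 1`.
  have hSK : S = ((p + q) / 2) • (1 : Module.End ℝ V) + (c * (q - p) / 2) • K := by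
    have e1 : (p + q) / 2 + c * (q - p) / 2 * -c = p := by linear_combination (p - q) / 2 * hcc
    have e2 : (p + q) / 2 + c * (q - p) / 2 * c = q := by linear_combination (q - p) / 2 * hcc
    refine b.ext fun i => ?_
    simp only [LinearMap.add_apply, LinearMap.smul_apply, Module.End.one_apply]
    fin_cases i
    · change S (b 0) = _ • b 0 + _ • K (b 0)
      rw [hp, hK0, smul_smul, ← add_smul, e1]
    · change S (b 1) = _ • b 1 + _ • K (b 1)
      rw [hp1, hK1, smul_smul, ← add_smul, e1]
    · change S (b 2) = _ • b 2 + _ • K (b 2)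
      rw [hq, hK2, smul_smul, ← add_smul, e2]
    · change S (b 3) = _ • b 3 + _ • K (b 3)
      rw [hq3, hK3, smul_smul, ← add_smul, e2]
  have hD : T * S - S * T = (c * (q - p) / 2) • (T * K - K * T) := by
    rw [hSK]
    simp only [mul_add, add_mul, mul_smul_comm, smul_mul_assoc, mul_one, one_mul, smul_sub]
    abel
  have hDK : (T * S - S * T) * K = K * (T * S - S * T) := by
    refine LinearMap.ext fun v => ?_
    simp only [Module.End.mul_apply, hK] at hDJ hDJ' ⊢
    rw [hDJ, hDJ']
  -- A commutator with an involution anticommutes with that involution, and `[T, S]` is a multiple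
  -- of `[T, K]`.
  have hDK' : (T * S - S * T) * K = -(K * (T * S - S * T)) := by
    have e : (T * K - K * T) * K = -(K * (T * K - K * T)) := by
      rw [sub_mul, mul_sub, mul_assoc T K K, hKK, ← mul_assoc K K T, hKK]
      simp [mul_assoc]
    rw [hD, smul_mul_assoc, mul_smul_comm, e, smul_neg]
  have h0 : K * (T * S - S * T) = 0 := by
    rw [hDK] at hDK'
    have h2 : (2 : ℝ) • (K * (T * S - S * T)) = 0 := by
      rw [two_smul]
      exact add_eq_zero_iff_eq_neg.mpr hDK'
    exact (smul_eq_zero.mp h2).resolve_left two_ne_zero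
  calc T * S - S * T = K * K * (T * S - S * T) := by rw [hKK, one_mul]
    _ = 0 := by rw [mul_assoc, h0, mul_zero]

end Algebra

section Form

open Module

variable {V : Type*} [AddCommGroup V] [Module ℝ V]

/-- Version of `commutator_eq_zero` for an inner product given as a bilinear form. -/
lemma commutator_eq_zero_of_form (hV : finrank ℝ V = 4) (B : V →ₗ[ℝ] V →ₗ[ℝ] ℝ)
    (hsymm : ∀ v w, B v w = B w v) (hpos : ∀ v, v ≠ 0 → 0 < B v v) {J J' S T : V →ₗ[ℝ] V}
    (hJ : ∀ v, J (J v) = -v) (hJo : ∀ v w, B (J v) (J w) = B v w)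
    (hJ' : ∀ v, J' (J' v) = -v) (hJo' : ∀ v w, B (J' v) (J' w) = B v w)
    (hor : InduceOppositeOrientations J J') (hS : ∀ v w, B (S v) w = B v (S w))
    (hSJ : ∀ v, S (J v) = J (S v)) (hSJ' : ∀ v, S (J' v) = J' (S v))
    (hDJ : ∀ v, (T * S - S * T) (J v) = J ((T * S - S * T) v))
    (hDJ' : ∀ v, (T * S - S * T) (J' v) = J' ((T * S - S * T) v)) :
    T * S - S * T = 0 := by
  let core : InnerProductSpace.Core ℝ V :=
    { inner := fun v w => B v w
      conj_inner_symm := fun v w => hsymm w v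
      re_inner_nonneg := fun v => by
        by_cases hv : v = 0
        · simp [hv]
        · exact (hpos v hv).le
      add_left := fun u v w => by simp
      smul_left := fun u v r => by simp
      definite := fun v hv => by
        by_contra h
        exact (hpos v h).ne' hv }
  let : NormedAddCommGroup V := core.toNormedAddCommGroup
  let : InnerProductSpace ℝ V := InnerProductSpace.ofCore core.toCore
  exact commutator_eq_zero hV hJ hJo hJ' hJo' hor hS hSJ hSJ' hDJ hDJ'

end Form

/-! ### The covariant derivative of the Ricci endomorphism and its commutation with the complex
structures. -/

section RicciDerivative

variable {E : Type*} [NormedAddCommGroup E] [NormedSpace ℝ E] [FiniteDimensional ℝ E]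
  {H : Type*} [TopologicalSpace H] {I : ModelWithCorners ℝ E H}
  {M : Type*} [TopologicalSpace M] [ChartedSpace H M] [IsManifold I ∞ M]
  {g : Metric I M} {ξ X Y Z : Π y : M, TangentSpace I y} {x : M}

lemma IsSmoothField.ricciEndo_apply (hX : IsSmoothField X) :
    IsSmoothField (fun y => ricciEndo g y (X y)) :=
  fun x => (smoothEndoNear_ricciEndo g x X (hX.smoothNear x)).contMDiffAt

/-- Lowering an index commutes with `∇` because the connection is metric. -/
lemma covDerivForm_ricciForm (hX : SmoothNear X x) (hY : SmoothNear Y x) (hZ : SmoothNear Z x) :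
    covDerivForm g X (ricciForm g) Y Z x =
      g.inner x (covDerivEndo g X (ricciEndo g) Y x) (Z x) := by
  have h := mvfderiv_inner (g := g) hX (smoothEndoNear_ricciEndo g x Y hY) hZ
  simp only [inner_ricciEndo] at h
  rw [covDerivForm, h, covDerivEndo, map_sub, sub_apply, inner_ricciEndo]
  ring

/-- If a Killing field is parallel to a complex structure commuting with the Ricci endomorphism,
then the complex structure commutes with the commutator `[∇ξ, Ric]`. -/
lemma IsKillingField.commutator_comm [T2Space M] (hξ : IsKillingField g ξ)
    {J : Π x : M, TangentSpace I x →ₗ[ℝ] TangentSpace I x} (hJs : IsSmoothEndo J)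
    (hc : ∀ x v, ricciEndo g x (J x v) = J x (ricciEndo g x v))
    (hJ : ∀ Y : Π x : M, TangentSpace I x, IsSmoothField Y → ∀ x, covDerivEndo g ξ J Y x = 0)
    {T : TangentSpace I x →ₗ[ℝ] TangentSpace I x} (hT : ∀ v, T v = leviCivita g ξ x v)
    (v : TangentSpace I x) :
    (T * ricciEndo g x - ricciEndo g x * T) (J x v) =
      J x ((T * ricciEndo g x - ricciEndo g x * T) v) := by
  obtain ⟨Y, hY, rfl⟩ := exists_isSmoothField_eq v
  -- The formula `∇_ξ Ric = [∇ξ, Ric]` is applied to `Y` and to `J Y`; as `∇_ξ J = 0`, `J` moves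
  -- through `∇_ξ` on both `Y` and `Ric Y`.
  have h1 := hξ.covDeriv_ricciEndo (hY.smoothNear x)
  have h2 := hξ.covDeriv_ricciEndo ((hJs Y hY).smoothNear x)
  have h3 := sub_eq_zero.mp (hJ Y hY x)
  have h4 := sub_eq_zero.mp (hJ _ (hY.ricciEndo_apply (g := g)) x)
  simp only [hc] at h2
  rw [h3, h4, hc, ← map_sub, h1] at h2
  simp only [LinearMap.sub_apply, Module.End.mul_apply, hT, hc]
  exact h2.symm

end RicciDerivative

/-! ### The tensor `S₀` on a four-dimensional Gray manifold and the conclusion. -/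

section Surface

variable {M : Type*} [TopologicalSpace M] [ChartedSpace (EuclideanSpace ℝ (Fin 4)) M]
  [IsManifold (𝓡 4) ∞ M] {g : Metric (𝓡 4) M} {ξ X Y Z : Π y : M, TangentSpace (𝓡 4) y} {x : M}

lemma SmoothNear.ricciKillingTensor_apply (g : Metric (𝓡 4) M) (hX : SmoothNear X x) :
    SmoothNear (fun y => ricciKillingTensor g y (X y)) x ∧
    ∀ W : Π y : M, TangentSpace (𝓡 4) y, covDerivEndo g W (ricciKillingTensor g) X x =
      covDerivEndo g W (ricciEndo g) X x - (mvfderiv (𝓡 4) (scalarCurvature g) x (W x) / 3) • X x := by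
  have hτ := smoothFunNear_scalarCurvature g x
  have h3 : SmoothFunNear (𝓡 4) (fun _ : M => (1 / 3 : ℝ)) x :=
    Eventually.of_forall fun _ => contMDiffAt_const
  have hf : SmoothFunNear (𝓡 4) (fun y => (1 / 3 : ℝ) * scalarCurvature g y) x := by
    filter_upwards [hτ, h3] with y h1 h2
    exact h2.mul h1
  have hR := smoothEndoNear_ricciEndo g x X hX
  have e : (fun y => ricciKillingTensor g y (X y)) =
      (fun y => ricciEndo g y (X y)) - (fun y => (1 / 3 : ℝ) * scalarCurvature g y) • X := by
    ext1 y
    simp only [ricciKillingTensor, LinearMap.sub_apply, LinearMap.smul_apply, LinearMap.id_apply,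
      Pi.sub_apply, Pi.smul_apply']
    congr 2
    ring
  refine ⟨e ▸ hR.sub (SmoothNear.smul hf hX), fun W => ?_⟩
  rw [covDerivEndo, e, covDeriv_sub_right hR (SmoothNear.smul hf hX), covDeriv_smul_right hf hX,
    mvfderiv_fun_mul h3.mdifferentiableAt hτ.mdifferentiableAt, mvfderiv_const, covDerivEndo]
  simp only [ricciKillingTensor, LinearMap.sub_apply, LinearMap.smul_apply, LinearMap.id_apply,
    smul_apply, smul_zero, add_zero, smul_eq_mul]
  module

/-- On a four-dimensional Gray manifold, `Ric - (τ / 3) Id` is a Killing tensor. -/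
lemma IsGrayManifold.isKillingTensor (hg : IsGrayManifold g) :
    IsKillingTensor g (ricciKillingTensor g) := by
  refine ⟨fun X hX x => ((hX.smoothNear x).ricciKillingTensor_apply g).1.contMDiffAt,
    fun X hX x => ?_⟩
  -- Equal arguments give `3 (∇_X ρ)(X, X) = (2/6) · 3 (Xτ) g(X, X)`; this is where the coefficient
  -- `1/3` of `τ` in `S₀` comes from.
  have h := hg X X X hX hX hX x
  have hX' := hX.smoothNear x
  rw [finrank_euclideanSpace_fin, covDerivForm_ricciForm hX' hX' hX'] at h
  rw [(hX'.ricciKillingTensor_apply g).2, map_sub, map_smul, sub_apply, smul_apply, smul_eq_mul]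
  push_cast at h
  linarith

/-- A Killing field `ξ` on a four-dimensional Gray manifold is mapped to a Killing field by
`Ric - (τ / 3) Id` if the Ricci endomorphism commutes with `∇ξ`. -/
lemma IsGrayManifold.isKillingField [T2Space M] (hg : IsGrayManifold g) (hξ : IsKillingField g ξ)
    (hc : ∀ (x : M) (v : TangentSpace (𝓡 4) x),
      leviCivita g ξ x (ricciEndo g x v) = ricciEndo g x (leviCivita g ξ x v)) :
    IsKillingField g (fun x => ricciKillingTensor g x (ξ x)) := by
  rw [isKillingField_iff (hg.isKillingTensor.1 ξ hξ.1)]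
  intro x
  -- The Killing equation is symmetric in its two arguments, so the diagonal case suffices, by
  -- polarization.
  have key : ∀ u : TangentSpace (𝓡 4) x,
      g.inner x (leviCivita g (fun x => ricciKillingTensor g x (ξ x)) x u) u = 0 := by
    intro u
    obtain ⟨X, hX, rfl⟩ := exists_isSmoothField_eq u
    have hX' := hX.smoothNear x
    have hξ' := hξ.1.smoothNear x
    have h1 := hg X X ξ hX hX hξ.1 x
    have h2 : covDerivForm g X (ricciForm g) X ξ x = covDerivForm g X (ricciForm g) ξ X x := by
      have : (fun y => ricciForm g y (X y) (ξ y)) = fun y => ricciForm g y (ξ y) (X y) :=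
        funext fun y => ricciForm_symm _ _
      simp only [covDerivForm, this]
      rw [ricciForm_symm (covDeriv g X X x), ricciForm_symm (X x)]
      ring
    have h3 : covDerivForm g ξ (ricciForm g) X X x = 0 := by
      rw [covDerivForm_ricciForm hξ' hX' hX', covDerivEndo, hξ.covDeriv_ricciEndo hX', hc,
        sub_self, map_zero, zero_apply]
    rw [finrank_euclideanSpace_fin, h2, h3, hξ.mvfderiv_scalarCurvature,
      covDerivForm_ricciForm hX' hξ' hX', g.symm x (X x) (ξ x)] at h1
    have h4 := (hξ'.ricciKillingTensor_apply g).2 X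
    have h5 : leviCivita g (fun x => ricciKillingTensor g x (ξ x)) x (X x) =
        covDerivEndo g X (ricciKillingTensor g) ξ x +
          ricciKillingTensor g x (leviCivita g ξ x (X x)) :=
      (sub_add_cancel _ _).symm
    -- `Ric` is symmetric and commutes with the skew map `∇ξ`, so their product is skew.
    have h6 : g.inner x (ricciEndo g x (leviCivita g ξ x (X x))) (X x) = 0 := by
      have e1 := hξ.skew (X x) (ricciEndo g x (X x))
      rw [hc, inner_ricciEndo_right, inner_ricciEndo_right,
        g.symm x (ricciEndo g x (X x)), inner_ricciEndo_right] at e1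
      linarith
    have h7 := hξ.skew (X x) (X x)
    rw [g.symm x (X x)] at h7
    rw [h5, h4]
    simp only [ricciKillingTensor, LinearMap.sub_apply, LinearMap.smul_apply, LinearMap.id_apply,
      map_add, map_sub, map_smul, add_apply, sub_apply, smul_apply, smul_eq_mul, h6]
    push_cast at h1
    have h8 : g.inner x (leviCivita g ξ x (X x)) (X x) = 0 := by linarith
    rw [h8]
    linarith
  intro u v
  have h := key (u + v)
  simp only [map_add, add_apply, key] at h
  rw [g.symm x u]
  linarith

end Surface

end BiHermitian


theorem proposition2 {M : Type*} [TopologicalSpace M] [T2Space M] [SecondCountableTopology M]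
    [ChartedSpace (EuclideanSpace ℝ (Fin 4)) M] [IsManifold (𝓡 4) ∞ M]
    (g : BiHermitian.Metric (𝓡 4) M)
    (J J' : Π x : M, TangentSpace (𝓡 4) x →ₗ[ℝ] TangentSpace (𝓡 4) x)
    (hM : BiHermitian.IsBiHermitianGraySurface g J J')
    (ξ : Π x : M, TangentSpace (𝓡 4) x)
    (hξ : BiHermitian.IsKillingField g ξ)
    (hJ : ∀ Y : Π x : M, TangentSpace (𝓡 4) x, BiHermitian.IsSmoothField Y →
      ∀ x, BiHermitian.covDerivEndo g ξ J Y x = 0)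
    (hJ' : ∀ Y : Π x : M, TangentSpace (𝓡 4) x, BiHermitian.IsSmoothField Y →
      ∀ x, BiHermitian.covDerivEndo g ξ J' Y x = 0) :
    BiHermitian.IsKillingTensor g (BiHermitian.ricciKillingTensor g) ∧
      BiHermitian.IsKillingField g (fun x => BiHermitian.ricciKillingTensor g x (ξ x)) := by
  refine ⟨hM.gray.isKillingTensor, hM.gray.isKillingField hξ fun x v => ?_⟩
  let T : TangentSpace (𝓡 4) x →ₗ[ℝ] TangentSpace (𝓡 4) x := BiHermitian.leviCivita g ξ x
  -- What remains is that `∇ξ` commutes with `Ric` at each point, an algebraic statement about one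
  -- tangent space.
  have h : T * BiHermitian.ricciEndo g x - BiHermitian.ricciEndo g x * T = 0 :=
    BiHermitian.commutator_eq_zero_of_form (V := TangentSpace (𝓡 4) x) finrank_euclideanSpace_fin
      (BiHermitian.flat g x : TangentSpace (𝓡 4) x →ₗ[ℝ] Module.Dual ℝ (TangentSpace (𝓡 4) x))
      (fun v w => g.symm x v w) (fun v hv => g.pos x v hv)
      (hM.hermitian.sq x) (hM.hermitian.orthogonal x)
      (hM.hermitian'.sq x) (hM.hermitian'.orthogonal x) (hM.opposite x)
      (fun v w => (BiHermitian.inner_ricciEndo_right v w).symm) (hM.commute x) (hM.commute' x)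
      (hξ.commutator_comm hM.hermitian.smooth hM.commute hJ fun _ => rfl)
      (hξ.commutator_comm hM.hermitian'.smooth hM.commute' hJ' fun _ => rfl)
  exact sub_eq_zero.mp congr($h v)
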